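/- **Proposition.** Let $N\ge 2$ be an integer and let $(X,d,m,\mathcal E,\mathcal F)$ be the $N$-dimensional Vicsek cable system defined below. Then the reverse Hölder inequality for the gradients of harmonic functions holds: there is a constant $C_H\in(0,+\infty)$ such that for every $x_0\in X$, every $r\in(0,+\infty)$ and every $u\in\mathcal F$ which is harmonic in $2B:=B(x_0,2r)$, with $B:=B(x_0,r)$, $$\bigl\||\nabla u|\bigr\|_{L^\infty(B)}\le \frac{C_H}{r}\,\frac1{m(2B)}\int_{2B}|u|\,\mathrm dm .$$ *The Vicsek graph.* In $\mathbb R^N$ let $p_1,\dots,p_{2^N}$ be the vertices of the cube $[0,2/\sqrt N]^N$, let $p_{2^N+1}=(1/\sqrt N,\dots,1/\sqrt N)$ be its center, and let $f_i(x)=\frac13x+\frac23p_i$. Put $V_0=\{p_1,\dots,p_{2^N+1}\}$, $V_{n+1}=\bigcup_i f_i(V_n)$ and $V=\bigcup_{n\ge0}3^nV_n$. Two points $p,q\in V$ are joined by an edge if $|p-q|=1$ and $p-q$ is parallel to a diagonal of the cube, i.e. $|p_k-q_k|=1/\sqrt N$ for all coordinates $k$ (if $4\nmid N$, the second condition follows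 from the first for $p,q\in V$). Let $E$ be the set of edges; $(V,E)$ is connected. *The cable system.* $X$ is the quotient of $E\times[0,1]$ which replaces each edge by a copy of $[0,1]$ (after an arbitrary choice of orientation) and glues these copies at common end points; $d$ is the geodesic distance on $X$ for which each edge has length $1$; $B(x,r)$ is the open ball; $m$ is the measure on $X$ which is Lebesgue measure on each edge. For a function $u$ on $X$, $\nabla u$ is its derivative along the edges, with respect to the chosen orientation (the vertices are $m$-null). Let $\mathcal K$ be the set of continuous functions with compact support which are differentiable at each interior point of each edge, have one-sided derivatives at the end points of each edge, and have an $m$-essentially bounded gradient. Put $\mathcal E(u,v)=\int_X\nabla u\,\nabla v\,\mathrm dm$ for $u,v\in\mathcal K$; let $\mathcal F\subseteq L^2(X;m)$ be the closure of $\mathcal K$ for the norm $(\mathcal E(u,u)+\|u\|_{2}^2)^{1/2}$, and extend $\nabla$ (with values in $L^2(X;m)$) and $\mathcal E$ to $\mathcal F$ by continuity. A function $u\in\mathcal F$ is harmonic in an open set $D\subseteq X$ if $\mathcal E(u,\varphi)=0$ for every $\varphi\in\mathcal F$ that is continuous with compact support contained in $D$. -/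

import Mathlib

open MeasureTheory Set Filter Topology
open scoped ENNReal

noncomputable section

/-! ## Cable systems -/

namespace CableSystem

variable {V : Type*} (G : SimpleGraph V)

/-- The source of an edge, for an arbitrarily chosen orientation. -/
def source (e : G.edgeSet) : V := (Quot.out e.1).1

/-- The target of an edge, for the same orientation. -/
def target (e : G.edgeSet) : V := (Quot.out e.1).2

/-- The chosen orientation is one: every edge joins its source to its target. -/
theorem mk_source_target (e : G.edgeSet) : s(source G e, target G e) = e.1 :=
  Quot.out_eq e.1

theorem adj_source_target (e : G.edgeSet) : G.Adj (source G e) (target G e) := by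
  have h := e.2
  rw [← mk_source_target G e] at h
  exact h

/-- A point of `E × [0,1]`: an edge together with a parameter in the unit interval (`0` stands for
the source of the edge, `1` for its target). -/
@[ext]
structure PrePoint (_hG : G.Connected) where
  edge : G.edgeSet
  pos : unitInterval

variable {G} {hG : G.Connected}

/-- The two end points of the cable containing `x`. -/
def PrePoint.endpoint (x : PrePoint G hG) : Bool → V
  | false => source G x.edge
  | true => target G x.edge

/-- The distance, along the cable containing `x`, from `x` to an end point of this cable. -/
def PrePoint.offset (x : PrePoint G hG) : Bool → ℝ
  | false => |(x.pos : ℝ)|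
  | true => |(x.pos : ℝ) - 1|

/-- The length of the shortest path from `x` to `y` which leaves the cable of `x` through its end
point `i` and enters the cable of `y` through its end point `j`. -/
def PrePoint.via (x y : PrePoint G hG) (i j : Bool) : ℝ :=
  x.offset i + (G.dist (x.endpoint i) (y.endpoint j) : ℝ) + y.offset j

/-- The geodesic distance of a cable system: inside one cable it is `|a - b|`, and between
different cables it is the minimum over the four ways to pass through end points. -/
def PrePoint.geodDist (x y : PrePoint G hG) : ℝ :=
  open scoped Classical in
  if x.edge = y.edge then |(x.pos : ℝ) - (y.pos : ℝ)|
  else min (min (x.via y false false) (x.via y false true))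
    (min (x.via y true false) (x.via y true true))

namespace PrePoint

theorem offset_nonneg (x : PrePoint G hG) (i : Bool) : 0 ≤ x.offset i := by
  cases i <;> exact abs_nonneg _

theorem offset_false (x : PrePoint G hG) : x.offset false = x.pos :=
  abs_of_nonneg x.pos.2.1

theorem offset_true (x : PrePoint G hG) : x.offset true = 1 - x.pos := by
  have := x.pos.2.2
  rw [offset, abs_of_nonpos (by linarith)]
  ring

theorem via_comm (x y : PrePoint G hG) (i j : Bool) : x.via y i j = y.via x j i := by
  unfold via
  rw [SimpleGraph.dist_comm]
  ring

theorem geodDist_self (x : PrePoint G hG) : x.geodDist x = 0 := by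
  simp [geodDist]

theorem geodDist_comm (x y : PrePoint G hG) : x.geodDist y = y.geodDist x := by
  unfold geodDist
  by_cases h : x.edge = y.edge
  · rw [if_pos h, if_pos h.symm, abs_sub_comm]
  · rw [if_neg h, if_neg (fun h' => h h'.symm), via_comm y x, via_comm y x, via_comm y x,
      via_comm y x]
    exact min_min_min_comm _ _ _ _

theorem geodDist_of_edge_eq {x y : PrePoint G hG} (h : x.edge = y.edge) :
    x.geodDist y = |(x.pos : ℝ) - (y.pos : ℝ)| := if_pos h

theorem exists_geodDist_eq_via {x y : PrePoint G hG} (h : x.edge ≠ y.edge) :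
    ∃ i j, x.geodDist y = x.via y i j := by
  unfold geodDist
  rw [if_neg h]
  rcases min_choice (min (x.via y false false) (x.via y false true))
    (min (x.via y true false) (x.via y true true)) with h1 | h1 <;> rw [h1]
  · rcases min_choice (x.via y false false) (x.via y false true) with h2 | h2 <;> rw [h2]
    exacts [⟨_, _, rfl⟩, ⟨_, _, rfl⟩]
  · rcases min_choice (x.via y true false) (x.via y true true) with h2 | h2 <;> rw [h2]
    exacts [⟨_, _, rfl⟩, ⟨_, _, rfl⟩]

theorem geodDist_le_via (x y : PrePoint G hG) (i j : Bool) : x.geodDist y ≤ x.via y i j := by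
  by_cases h : x.edge = y.edge
  · rw [geodDist_of_edge_eq h]
    have hx := x.pos.2
    have hy := y.pos.2
    have h1 : G.dist (source G y.edge) (target G y.edge) = 1 :=
      SimpleGraph.dist_eq_one_iff_adj.2 (adj_source_target G _)
    have h2 : G.dist (target G y.edge) (source G y.edge) = 1 :=
      SimpleGraph.dist_eq_one_iff_adj.2 (adj_source_target G _).symm
    cases i <;> cases j <;>
      simp only [via, endpoint, h, h1, h2, SimpleGraph.dist_self, offset_false, offset_true,
        Nat.cast_zero, Nat.cast_one] <;> rw [abs_le] <;> constructor <;>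
      linarith [hx.1, hx.2, hy.1, hy.2]
  · unfold geodDist
    rw [if_neg h]
    cases i <;> cases j <;> simp

theorem offset_le (x y : PrePoint G hG) (i : Bool) :
    x.offset i ≤ |(x.pos : ℝ) - (y.pos : ℝ)| + y.offset i := by
  have h1 := le_abs_self ((x.pos : ℝ) - (y.pos : ℝ))
  have h2 := neg_abs_le ((x.pos : ℝ) - (y.pos : ℝ))
  cases i
  · rw [offset_false, offset_false]; linarith
  · rw [offset_true, offset_true]; linarith

theorem endpoint_congr {x y : PrePoint G hG} (h : x.edge = y.edge) : x.endpoint = y.endpoint := by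
  funext i
  cases i <;> simp [endpoint, h]

theorem dist_endpoint_le (y : PrePoint G hG) (i j : Bool) :
    (G.dist (y.endpoint i) (y.endpoint j) : ℝ) ≤ y.offset i + y.offset j := by
  have h1 : G.dist (source G y.edge) (target G y.edge) = 1 :=
    SimpleGraph.dist_eq_one_iff_adj.2 (adj_source_target G _)
  have h2 : G.dist (target G y.edge) (source G y.edge) = 1 :=
    SimpleGraph.dist_eq_one_iff_adj.2 (adj_source_target G _).symm
  have hf := y.offset_nonneg false
  have ht := y.offset_nonneg true
  cases i <;> cases j <;>
    simp only [endpoint, h1, h2, SimpleGraph.dist_self, Nat.cast_zero, Nat.cast_one]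
  · linarith
  · rw [offset_false, offset_true]; linarith
  · rw [offset_false, offset_true]; linarith
  · linarith

theorem geodDist_triangle (x y z : PrePoint G hG) :
    x.geodDist z ≤ x.geodDist y + y.geodDist z := by
  by_cases hxy : x.edge = y.edge <;> by_cases hyz : y.edge = z.edge
  · rw [geodDist_of_edge_eq hxy, geodDist_of_edge_eq hyz, geodDist_of_edge_eq (hxy.trans hyz)]
    exact abs_sub_le _ _ _
  · obtain ⟨i, j, hij⟩ := exists_geodDist_eq_via hyz
    have h1 := x.geodDist_le_via z i j
    have h2 := offset_le x y i
    rw [geodDist_of_edge_eq hxy, hij]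
    unfold via at h1 ⊢
    rw [endpoint_congr hxy] at h1
    linarith
  · obtain ⟨i, j, hij⟩ := exists_geodDist_eq_via hxy
    have h1 := x.geodDist_le_via z i j
    have h2 := offset_le z y j
    rw [geodDist_of_edge_eq hyz, hij, abs_sub_comm]
    unfold via at h1 ⊢
    rw [← endpoint_congr hyz] at h1
    linarith
  · obtain ⟨i, j, hij⟩ := exists_geodDist_eq_via hxy
    obtain ⟨k, l, hkl⟩ := exists_geodDist_eq_via hyz
    have h1 := x.geodDist_le_via z i l
    have h2 := y.dist_endpoint_le j k
    have h3 : (G.dist (x.endpoint i) (z.endpoint l) : ℝ) ≤ G.dist (x.endpoint i) (y.endpoint j) +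
        (G.dist (y.endpoint j) (y.endpoint k) + G.dist (y.endpoint k) (z.endpoint l)) := by
      exact_mod_cast (hG.dist_triangle).trans (Nat.add_le_add_left hG.dist_triangle _)
    rw [hij, hkl]
    unfold via at h1 ⊢
    linarith

instance : PseudoMetricSpace (PrePoint G hG) where
  dist := geodDist
  dist_self := geodDist_self
  dist_comm := geodDist_comm
  dist_triangle := geodDist_triangle

end PrePoint

end CableSystem

/-- The cable system of a connected graph: the quotient of `E × [0,1]` which glues the cables at
their common end points, that is, which identifies the points at geodesic distance `0`. It is a
metric space for the geodesic distance. -/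
abbrev CableSystem {V : Type*} (G : SimpleGraph V) (hG : G.Connected) : Type _ :=
  SeparationQuotient (CableSystem.PrePoint G hG)

namespace CableSystem

variable {V : Type*} {G : SimpleGraph V} {hG : G.Connected}

/-- The quotient map `E × [0,1] → X`. -/
def proj (hG : G.Connected) (e : G.edgeSet) (a : unitInterval) : CableSystem G hG :=
  SeparationQuotient.mk ⟨e, a⟩

instance : MeasurableSpace (CableSystem G hG) := borel _

instance : BorelSpace (CableSystem G hG) := ⟨rfl⟩

/-- Each closed cable is embedded isometrically. -/
theorem isometry_proj (hG : G.Connected) (e : G.edgeSet) : Isometry (proj hG e) :=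
  Isometry.of_dist_eq fun _ _ => PrePoint.geodDist_of_edge_eq rfl

/-- The measure of a cable system: the sum over all cables of the one-dimensional Lebesgue
measure. -/
def cableMeasure (G : SimpleGraph V) (hG : G.Connected) : Measure (CableSystem G hG) :=
  Measure.sum fun e : G.edgeSet => Measure.map (proj hG e) volume

/-- The restriction of `u` to the closed cable `e`, as a function of the parameter in `[0,1]`
(extended to `ℝ` by constants). -/
def onCable (u : CableSystem G hG → ℝ) (e : G.edgeSet) (t : ℝ) : ℝ :=
  u (proj hG e (projIcc 0 1 zero_le_one t))

/-- The pointwise gradient of `u`. Its value at a point of an open cable is the derivative of `u`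
along the cable, with respect to the chosen orientation; the vertices form a null set, and the value
there is irrelevant. -/
def grad (u : CableSystem G hG → ℝ) (x : CableSystem G hG) : ℝ :=
  deriv (onCable u (Quotient.out x).edge) (Quotient.out x).pos

/-- The class of continuous, compactly supported functions which have a derivative at each point of
each open cable, all directional derivatives at the vertices, and an essentially bounded
gradient. -/
def coreFunctions (G : SimpleGraph V) (hG : G.Connected) : Set (CableSystem G hG → ℝ) :=
  {u | Continuous u ∧ HasCompactSupport u ∧
    (∀ e, DifferentiableOn ℝ (onCable u e) (Icc 0 1)) ∧
    eLpNorm (grad u) ∞ (cableMeasure G hG) < ∞}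

/-- The pair `(u, g)` belongs to the closure in `L² × L²` of the graph of the gradient on the core
functions. -/
def HasEnergyGrad (u g : CableSystem G hG → ℝ) : Prop :=
  MemLp u 2 (cableMeasure G hG) ∧ MemLp g 2 (cableMeasure G hG) ∧
    ∃ w : ℕ → CableSystem G hG → ℝ, (∀ n, w n ∈ coreFunctions G hG) ∧
      Tendsto (fun n => eLpNorm (w n - u) 2 (cableMeasure G hG)) atTop (𝓝 0) ∧
      Tendsto (fun n => eLpNorm (grad (w n) - g) 2 (cableMeasure G hG)) atTop (𝓝 0)

/-- The domain of the Dirichlet form: the closure of the core functions for the norm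
`(∫ |∇u|² dm + ∫ u² dm)^{1/2}`. -/
def formDomain (G : SimpleGraph V) (hG : G.Connected) : Set (CableSystem G hG → ℝ) :=
  {u | ∃ g, HasEnergyGrad u g}

/-- The gradient of a function of the form domain, a square integrable function which is determined
almost everywhere. Its square is the density of the energy measure of `u` with respect to the
measure of the cable system. -/
def energyGrad (u : CableSystem G hG → ℝ) : CableSystem G hG → ℝ :=
  open scoped Classical in
  if h : ∃ g, HasEnergyGrad u g then h.choose else 0

/-- The Dirichlet form `𝓔(u, v) = ∫ ∇u ∇v dm` (each cable is counted once). -/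
def energy (u v : CableSystem G hG → ℝ) : ℝ :=
  ∫ x, energyGrad u x * energyGrad v x ∂(cableMeasure G hG)

/-- `u` is harmonic in the open set `D`: it belongs to the form domain and `𝓔(u, φ) = 0` for every
`φ` in the form domain which is continuous with compact support contained in `D`. -/
def IsHarmonicIn (u : CableSystem G hG → ℝ) (D : Set (CableSystem G hG)) : Prop :=
  u ∈ formDomain G hG ∧ ∀ φ ∈ formDomain G hG, Continuous φ → HasCompactSupport φ →
    tsupport φ ⊆ D → energy u φ = 0

/-- The classical reverse Hölder inequality for the gradients of harmonic functions:
`‖|∇u|‖_{L^∞(B)} ≤ (C / r) ⨍_{2B} |u| dm` for every ball `B = B(x₀, r)` and every `u` in the form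
domain which is harmonic in `2B = B(x₀, 2r)`. -/
def ReverseHolder (G : SimpleGraph V) (hG : G.Connected) : Prop :=
  ∃ C : ℝ, 0 < C ∧ ∀ (x₀ : CableSystem G hG) (r : ℝ), 0 < r →
    ∀ u ∈ formDomain G hG, IsHarmonicIn u (Metric.ball x₀ (2 * r)) →
      eLpNorm (energyGrad u) ∞ ((cableMeasure G hG).restrict (Metric.ball x₀ r)) ≤
        ENNReal.ofReal (C / r * ⨍ x in Metric.ball x₀ (2 * r), |u x| ∂(cableMeasure G hG))

end CableSystem

/-! ## The Vicsek graph -/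

namespace Vicsek

/-- The vertices of the cube `[0, 2/√N]^N`. -/
def corners (N : ℕ) : Set (EuclideanSpace ℝ (Fin N)) :=
  {p | ∀ k, p k = 0 ∨ p k = 2 / √N}

/-- The center of the cube `[0, 2/√N]^N`. -/
def center (N : ℕ) : EuclideanSpace ℝ (Fin N) :=
  WithLp.toLp 2 fun _ => 1 / √N

/-- The `2^N + 1` points `p_i`: the vertices of the cube and its center. -/
def nodes (N : ℕ) : Set (EuclideanSpace ℝ (Fin N)) :=
  insert (center N) (corners N)

/-- The contraction with ratio `1/3` and fixed point `p`. -/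
def contraction {N : ℕ} (p x : EuclideanSpace ℝ (Fin N)) : EuclideanSpace ℝ (Fin N) :=
  (1 / 3 : ℝ) • x + (2 / 3 : ℝ) • p

/-- The finite approximations `V_n` of the Vicsek set. -/
def level (N : ℕ) : ℕ → Set (EuclideanSpace ℝ (Fin N))
  | 0 => nodes N
  | n + 1 => ⋃ p ∈ nodes N, contraction p '' level N n

/-- The blown-up approximations `3^n V_n`. -/
def scaledLevel (N n : ℕ) : Set (EuclideanSpace ℝ (Fin N)) :=
  (fun v => (3 : ℝ) ^ n • v) '' level N n

/-- The vertices of the Vicsek graph: the union of all `3^n V_n`. -/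
def vertices (N : ℕ) : Set (EuclideanSpace ℝ (Fin N)) :=
  ⋃ n, scaledLevel N n

/-- Two vertices are joined by a cable if they are at Euclidean distance `1` and their difference
is parallel to a diagonal of the cube. These are exactly the pairs which consist of the center and a
vertex of one of the copies of the cube `[0, 2/√N]^N` that make up the graph. The second condition
follows from the first one unless `4 ∣ N`; if `4 ∣ N`, then two vertices of the cube may be at
distance `1`, and they are not joined by a cable. -/
def Joined {N : ℕ} (p q : EuclideanSpace ℝ (Fin N)) : Prop :=
  dist p q = 1 ∧ ∀ k, |p k - q k| = 1 / √N

/-- The `N`-dimensional Vicsek graph. -/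
def graph (N : ℕ) : SimpleGraph (vertices N) where
  Adj p q := Joined p.1 q.1
  symm := ⟨fun p q h => ⟨dist_comm p.1 q.1 ▸ h.1, fun k => abs_sub_comm (p.1 k) (q.1 k) ▸ h.2 k⟩⟩
  loopless := ⟨fun p h => by simpa using h.1⟩

theorem zero_mem_corners (N : ℕ) : (0 : EuclideanSpace ℝ (Fin N)) ∈ corners N :=
  fun _ => Or.inl rfl

theorem opposite_mem_corners {N : ℕ} {p : EuclideanSpace ℝ (Fin N)} (hp : p ∈ corners N) :
    (2 : ℝ) • center N - p ∈ corners N := by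
  intro k
  have h : ((2 : ℝ) • center N - p) k = 2 / √N - p k := by
    simp [center]; ring
  rw [h]
  rcases hp k with h0 | h0 <;> rw [h0] <;> simp

theorem mem_scaledLevel_succ {N n : ℕ} {x : EuclideanSpace ℝ (Fin N)} :
    x ∈ scaledLevel N (n + 1) ↔
      ∃ p ∈ nodes N, ∃ y ∈ scaledLevel N n, x = y + (2 * 3 ^ n : ℝ) • p := by
  have key : ∀ p v : EuclideanSpace ℝ (Fin N),
      (3 : ℝ) ^ (n + 1) • contraction p v = (3 : ℝ) ^ n • v + (2 * 3 ^ n : ℝ) • p := by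
    intro p v
    unfold contraction
    rw [smul_add, smul_smul, smul_smul]
    congr 2 <;> ring
  constructor
  · rintro ⟨z, hz, rfl⟩
    simp only [level, mem_iUnion] at hz
    obtain ⟨p, hp, v, hv, rfl⟩ := hz
    exact ⟨p, hp, _, ⟨v, hv, rfl⟩, key p v⟩
  · rintro ⟨p, hp, _, ⟨v, hv, rfl⟩, rfl⟩
    refine ⟨contraction p v, ?_, key p v⟩
    simp only [level, mem_iUnion]
    exact ⟨p, hp, v, hv, rfl⟩

theorem smul_mem_scaledLevel {N : ℕ} {p : EuclideanSpace ℝ (Fin N)} (hp : p ∈ corners N) (n : ℕ) :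
    (3 : ℝ) ^ n • p ∈ scaledLevel N n := by
  induction n with
  | zero => exact ⟨p, mem_insert_of_mem _ hp, rfl⟩
  | succ n ih =>
    refine mem_scaledLevel_succ.2 ⟨p, mem_insert_of_mem _ hp, _, ih, ?_⟩
    rw [← add_smul]
    congr 1
    ring

theorem scaledLevel_subset_succ (N n : ℕ) : scaledLevel N n ⊆ scaledLevel N (n + 1) := fun x hx =>
  mem_scaledLevel_succ.2 ⟨0, mem_insert_of_mem _ (zero_mem_corners N), x, hx, by simp⟩

theorem joined_symm {N : ℕ} {p q : EuclideanSpace ℝ (Fin N)} (h : Joined p q) : Joined q p :=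
  ⟨dist_comm p q ▸ h.1, fun k => abs_sub_comm (p k) (q k) ▸ h.2 k⟩

theorem joined_add {N : ℕ} {p q : EuclideanSpace ℝ (Fin N)} (h : Joined p q)
    (v : EuclideanSpace ℝ (Fin N)) : Joined (p + v) (q + v) :=
  ⟨by rw [dist_add_right]; exact h.1, fun k => by simpa using h.2 k⟩

theorem joined_center {N : ℕ} (hN : 0 < N) {p : EuclideanSpace ℝ (Fin N)} (hp : p ∈ corners N) :
    Joined p (center N) := by
  have h : ∀ k, |p k - center N k| = 1 / √N := by
    intro k
    have h0 : (0 : ℝ) ≤ 1 / √N := by positivity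
    rcases hp k with hk | hk
    · rw [hk]
      simp [center]
    · rw [hk]
      have : (2 : ℝ) / √N - center N k = 1 / √N := by simp [center]; ring
      rw [this, abs_of_nonneg h0]
  refine ⟨?_, h⟩
  rw [EuclideanSpace.dist_eq]
  have hN' : (0 : ℝ) < N := by exact_mod_cast hN
  have : ∀ k, dist (p k) (center N k) ^ 2 = 1 / (N : ℝ) := by
    intro k
    rw [Real.dist_eq, h k, div_pow, Real.sq_sqrt hN'.le, one_pow]
  simp only [this, Finset.sum_const, Finset.card_univ, Fintype.card_fin, nsmul_eq_mul]
  rw [mul_one_div_cancel hN'.ne', Real.sqrt_one]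

/-- One step along a cable between two points of `3^n V_n`. -/
def Step (N n : ℕ) (a b : EuclideanSpace ℝ (Fin N)) : Prop :=
  a ∈ scaledLevel N n ∧ b ∈ scaledLevel N n ∧ Joined a b

theorem chain_of_mem {N : ℕ} (hN : 0 < N) (n : ℕ) :
    ∀ x ∈ scaledLevel N n, ∀ y ∈ scaledLevel N n, Relation.ReflTransGen (Step N n) x y := by
  induction n with
  | zero =>
    have h0 : scaledLevel N 0 = nodes N := by simp [scaledLevel, level]
    have hc : center N ∈ scaledLevel N 0 := h0 ▸ mem_insert _ _
    have h1 : ∀ x ∈ scaledLevel N 0, Relation.ReflTransGen (Step N 0) x (center N) ∧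
        Relation.ReflTransGen (Step N 0) (center N) x := by
      intro x hx
      rcases (h0 ▸ hx : x ∈ nodes N) with rfl | h
      · exact ⟨.refl, .refl⟩
      · have hj := joined_center hN h
        exact ⟨.single ⟨hx, hc, hj⟩, .single ⟨hc, hx, joined_symm hj⟩⟩
    intro x hx y hy
    exact (h1 x hx).1.trans (h1 y hy).2
  | succ n ih =>
    have block : ∀ p ∈ nodes N, ∀ x ∈ scaledLevel N n, ∀ y ∈ scaledLevel N n,
        Relation.ReflTransGen (Step N (n + 1)) (x + (2 * 3 ^ n : ℝ) • p)
          (y + (2 * 3 ^ n : ℝ) • p) := by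
      intro p hp x hx y hy
      refine (ih x hx y hy).lift (fun z => z + (2 * 3 ^ n : ℝ) • p) ?_
      rintro a b ⟨ha, hb, hab⟩
      exact ⟨mem_scaledLevel_succ.2 ⟨p, hp, a, ha, rfl⟩, mem_scaledLevel_succ.2 ⟨p, hp, b, hb, rfl⟩,
        joined_add hab _⟩
    have hub : ∀ x ∈ scaledLevel N (n + 1), ∃ z ∈ scaledLevel N n,
        Relation.ReflTransGen (Step N (n + 1)) x (z + (2 * 3 ^ n : ℝ) • center N) ∧
        Relation.ReflTransGen (Step N (n + 1)) (z + (2 * 3 ^ n : ℝ) • center N) x := by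
      intro x hx
      obtain ⟨p, hp, y, hy, rfl⟩ := mem_scaledLevel_succ.1 hx
      rcases id hp with rfl | hpc
      · exact ⟨y, hy, .refl, .refl⟩
      · refine ⟨(3 : ℝ) ^ n • p, smul_mem_scaledLevel hpc n, ?_⟩
        have ho := smul_mem_scaledLevel (opposite_mem_corners hpc) n
        have he : (3 : ℝ) ^ n • p + (2 * 3 ^ n : ℝ) • center N =
            (3 : ℝ) ^ n • ((2 : ℝ) • center N - p) + (2 * 3 ^ n : ℝ) • p := by
          module
        rw [he]
        exact ⟨block p hp _ hy _ ho, block p hp _ ho _ hy⟩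
    intro x hx y hy
    obtain ⟨z, hz, hxz, -⟩ := hub x hx
    obtain ⟨w, hw, -, hwy⟩ := hub y hy
    exact (hxz.trans (block _ (mem_insert _ _) z hz w hw)).trans hwy

/-- The Vicsek graph is connected. -/
theorem graph_connected {N : ℕ} (hN : 0 < N) : (graph N).Connected := by
  have mono : Monotone (scaledLevel N) := monotone_nat_of_le_succ (scaledLevel_subset_succ N)
  have hsub : ∀ n, scaledLevel N n ⊆ vertices N := fun n => subset_iUnion _ n
  have lift : ∀ (n : ℕ) (x y : EuclideanSpace ℝ (Fin N)), Relation.ReflTransGen (Step N n) x y →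
      ∀ (hx : x ∈ vertices N) (hy : y ∈ vertices N), (graph N).Reachable ⟨x, hx⟩ ⟨y, hy⟩ := by
    intro n x y h
    induction h with
    | refl => intro _ _; exact SimpleGraph.Reachable.refl _
    | tail _ hbc ih =>
      intro hx hy
      have hb := hsub n hbc.1
      have hadj : (graph N).Adj ⟨_, hb⟩ ⟨_, hy⟩ := hbc.2.2
      exact (ih hx hb).trans hadj.reachable
  have hne : Nonempty (vertices N) :=
    ⟨⟨_, hsub 0 (smul_mem_scaledLevel (zero_mem_corners N) 0)⟩⟩
  refine ⟨?_⟩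
  rintro ⟨x, hx⟩ ⟨y, hy⟩
  obtain ⟨i, hi⟩ := mem_iUnion.1 hx
  obtain ⟨j, hj⟩ := mem_iUnion.1 hy
  exact lift (max i j) x y (chain_of_mem hN _ x (mono (le_max_left i j) hi) y
    (mono (le_max_right i j) hj)) hx hy

/-- In the unit `1 / √N`, the coordinates of a vertex are integers of the same parity. -/
theorem exists_int_coord {N n : ℕ} {x : EuclideanSpace ℝ (Fin N)} (hx : x ∈ scaledLevel N n) :
    ∃ (a : Fin N → ℤ) (c : ℤ), ∀ k, x k = (2 * a k + c : ℤ) / √N := by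
  have node : ∀ p ∈ nodes N, ∃ b : Fin N → ℤ, ∀ k, p k = (b k : ℝ) / √N := by
    rintro p (rfl | hp)
    · exact ⟨fun _ => 1, fun k => by simp [center]⟩
    · refine ⟨fun k => if p k = 0 then 0 else 2, fun k => ?_⟩
      rcases hp k with h | h
      · simp [h]
      · by_cases h0 : p k = 0
        · simp [h0]
        · simp only [h0, if_false]
          simpa using h
  induction n generalizing x with
  | zero =>
    have h0 : scaledLevel N 0 = nodes N := by simp [scaledLevel, level]
    rcases (h0 ▸ hx : x ∈ nodes N) with rfl | hp
    · exact ⟨fun _ => 0, 1, fun k => by simp [center]⟩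
    · refine ⟨fun k => if x k = 0 then 0 else 1, 0, fun k => ?_⟩
      rcases hp k with h | h
      · simp [h]
      · by_cases h0 : x k = 0
        · simp [h0]
        · simp only [h0, if_false]
          simpa using h
  | succ n ih =>
    obtain ⟨p, hp, y, hy, rfl⟩ := mem_scaledLevel_succ.1 hx
    obtain ⟨a, c, ha⟩ := ih hy
    obtain ⟨b, hb⟩ := node p hp
    refine ⟨fun k => a k + 3 ^ n * b k, c, fun k => ?_⟩
    simp only [PiLp.add_apply, PiLp.smul_apply, smul_eq_mul, ha k, hb k]
    push_cast
    ring

/-- Unless `4 ∣ N`, two vertices are joined by a cable as soon as their distance is `1`. -/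
theorem joined_iff_dist_eq_one {N : ℕ} (hN : ¬ 4 ∣ N) {p q : EuclideanSpace ℝ (Fin N)}
    (hp : p ∈ vertices N) (hq : q ∈ vertices N) : Joined p q ↔ dist p q = 1 := by
  refine ⟨fun h => h.1, fun h => ⟨h, ?_⟩⟩
  obtain ⟨i, hi⟩ := mem_iUnion.1 hp
  obtain ⟨j, hj⟩ := mem_iUnion.1 hq
  obtain ⟨a, c, ha⟩ := exists_int_coord hi
  obtain ⟨b, d, hb⟩ := exists_int_coord hj
  have hN0 : 0 < N := Nat.pos_of_ne_zero (fun h0 => hN (h0 ▸ dvd_zero 4))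
  have hN' : (0 : ℝ) < N := by exact_mod_cast hN0
  have hdiff : ∀ k, p k - q k = (2 * (a k - b k) + (c - d) : ℤ) / √N := by
    intro k
    rw [ha, hb]
    push_cast
    ring
  have hsum : ∑ k, (2 * (a k - b k) + (c - d)) ^ 2 = (N : ℤ) := by
    rw [EuclideanSpace.dist_eq, Real.sqrt_eq_one] at h
    simp only [Real.dist_eq, sq_abs, hdiff, div_pow, Real.sq_sqrt hN'.le] at h
    rw [← Finset.sum_div, div_eq_one_iff_eq hN'.ne'] at h
    exact_mod_cast h
  rcases Int.even_or_odd' (c - d) with ⟨e, he | he⟩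
  · exfalso
    apply hN
    have : (4 : ℤ) ∣ N := by
      rw [← hsum]
      refine Finset.dvd_sum fun k _ => ⟨(a k - b k + e) ^ 2, ?_⟩
      rw [he]
      ring
    exact_mod_cast this
  · have hge : ∀ k ∈ Finset.univ, (1 : ℤ) ≤ (2 * (a k - b k) + (c - d)) ^ 2 := by
      intro k _
      rw [he]
      have : 2 * (a k - b k) + (2 * e + 1) ≠ 0 := by omega
      have := pow_pos (abs_pos.2 this) 2
      rw [sq_abs] at this
      omega
    have heq := (Finset.sum_eq_sum_iff_of_le hge).1 (by rw [hsum]; simp)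
    intro k
    have h1 : |((2 * (a k - b k) + (c - d) : ℤ) : ℝ)| = 1 := by
      have := (heq k (Finset.mem_univ k)).symm
      rcases sq_eq_sq_iff_eq_or_eq_neg.1 (this.trans (one_pow 2).symm) with h2 | h2 <;> rw [h2] <;> simp
    rw [hdiff, abs_div, h1, abs_of_nonneg (Real.sqrt_nonneg _)]

end Vicsek

end

/-!
The cable system of the Vicsek graph is a tree, and the harmonic functions on a cell `3^m V_m` are
very rigid: apart from the segments which join the center of the cell to its corners, the cell
consists of dead ends. No flux enters a dead end, so a function which is harmonic in the cell
except at its corners is constant on each dead end branch and affine on each of these segments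
(`HarmonicInCell.sum_flux_and_affine`, `HarmonicInCell.abs_sub_le`,
`HarmonicInCell.eq_center_of_flux_eq_zero`). In particular the gradient on the cell is bounded by
the slopes along the segments.

In dimension `N ≥ 2`, dead ends branch off each segment at the centers of the two subcells of level
`m - 1` and `m - 2` at its corner. On these dead ends, which contain cells of level `m - 3`, the
function is constant, with the value that it has at the branching point. The two points have
distance `2 * 3^(m - 2)`, hence the slope is bounded by `3^(-m)` times the mean value of `|u|` over
the dead ends, up to a constant (`HarmonicInCell.exists_dead_cells`). For `3^m` comparable to `r`
and a cell that meets `B`, the cell lies in `2B` and has measure comparable to that of `2B`: both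
are of the order `(2^N + 1)^m` (`exists_cables_of_cell`, `exists_cables_of_ball`). This is the
reverse Hölder inequality. For bounded `r`, the function is affine on an interval of length
comparable to `r` in a single cable, and its slope is controlled directly
(`IsHarmonicIn.ae_abs_grad_le_of_ball`).

The passage from the Dirichlet form to affine functions is elementary, because the space is
one-dimensional. A function `u` of the form domain has a representative that is a primitive of its
gradient on every cable (`HasEnergyGrad.exists_primitive`), so the gradient is unique and the energy
against an explicit test function can be computed (`energy_glue`). Tests supported in one cable show
that the gradient of a harmonic function is constant along the cable
(`IsHarmonicIn.exists_grad_eq_const`), and hat functions at a vertex give Kirchhoff's law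
(`IsHarmonicIn.sum_sub_eq_zero`).

The combinatorics of the cells is done in integer coordinates, in the unit `1 / √N`. Two cells of
the same level meet in a common corner at most (`cell_inter`), because they lie in cubes and all
coordinates of the offset of a cell have the same parity.
-/

open scoped NNReal

noncomputable section

namespace CableSystem

variable {V : Type*} {G : SimpleGraph V} {hG : G.Connected}

/-! ### Cables and measure -/

/-- The point with parameter `t` on the cable `e`, the parameter being clamped to `[0, 1]`. In
contrast to `proj`, the parameter is a real number. -/
def cablePoint (hG : G.Connected) (e : G.edgeSet) (t : ℝ) : CableSystem G hG :=
  proj hG e (projIcc 0 1 zero_le_one t)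

theorem onCable_apply (u : CableSystem G hG → ℝ) (e : G.edgeSet) (t : ℝ) :
    onCable u e t = u (cablePoint hG e t) := rfl

theorem cablePoint_of_mem (e : G.edgeSet) {t : ℝ} (ht : t ∈ Icc (0 : ℝ) 1) :
    cablePoint hG e t = proj hG e ⟨t, ht⟩ := by
  rw [cablePoint, projIcc_of_mem _ ht]

theorem exists_eq_proj (x : CableSystem G hG) : ∃ e a, x = proj hG e a := by
  obtain ⟨x, rfl⟩ := SeparationQuotient.surjective_mk x
  exact ⟨x.edge, x.pos, rfl⟩

theorem exists_eq_cablePoint (x : CableSystem G hG) :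
    ∃ e, ∃ t ∈ Icc (0 : ℝ) 1, x = cablePoint hG e t := by
  obtain ⟨e, a, rfl⟩ := exists_eq_proj x
  exact ⟨e, a, a.2, by rw [cablePoint_of_mem]⟩

theorem continuous_cablePoint (e : G.edgeSet) : Continuous (cablePoint hG e) :=
  (isometry_proj hG e).continuous.comp continuous_projIcc

theorem dist_cablePoint (e : G.edgeSet) {s t : ℝ} (hs : s ∈ Icc (0 : ℝ) 1)
    (ht : t ∈ Icc (0 : ℝ) 1) : dist (cablePoint hG e s) (cablePoint hG e t) = |s - t| := by
  rw [cablePoint_of_mem e hs, cablePoint_of_mem e ht, (isometry_proj hG e).dist_eq]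
  rfl

theorem measurableEmbedding_proj (e : G.edgeSet) : MeasurableEmbedding (proj hG e) :=
  (isometry_proj hG e).isClosedEmbedding.measurableEmbedding

theorem map_cablePoint (e : G.edgeSet) :
    Measure.map (cablePoint hG e) (volume.restrict (Icc 0 1)) =
      Measure.map (proj hG e) volume := by
  rw [← (unitInterval.measurePreserving_coe).map_eq, Measure.map_map
    (continuous_cablePoint e).measurable measurable_subtype_coe]
  congr 1
  funext a
  exact congrArg (proj hG e) (projIcc_val zero_le_one a)

theorem map_cablePoint_le (e : G.edgeSet) :
    Measure.map (cablePoint hG e) (volume.restrict (Icc 0 1)) ≤ cableMeasure G hG := by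
  rw [map_cablePoint]
  exact Measure.le_sum (fun e : G.edgeSet => Measure.map (proj hG e) volume) e

theorem ae_cablePoint (e : G.edgeSet) {p : CableSystem G hG → Prop}
    (h : ∀ᵐ x ∂(cableMeasure G hG), p x) :
    ∀ᵐ t ∂(volume.restrict (Icc (0 : ℝ) 1)), p (cablePoint hG e t) :=
  ae_of_ae_map (continuous_cablePoint e).aemeasurable (ae_mono (map_cablePoint_le e) h)

theorem ae_cableMeasure_iff [Countable G.edgeSet] {p : CableSystem G hG → Prop} :
    (∀ᵐ x ∂(cableMeasure G hG), p x) ↔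
      ∀ e, ∀ᵐ t ∂(volume.restrict (Icc (0 : ℝ) 1)), p (cablePoint hG e t) := by
  refine ⟨fun h e => ae_cablePoint e h, fun h => ?_⟩
  rw [cableMeasure, Measure.ae_sum_iff]
  intro e
  rw [(measurableEmbedding_proj e).ae_map_iff]
  have := h e
  rw [← (unitInterval.measurePreserving_coe).map_eq,
    unitInterval.measurableEmbedding_coe.ae_map_iff] at this
  filter_upwards [this] with a ha
  rwa [cablePoint_of_mem e a.2] at ha

theorem lintegral_cableMeasure (f : CableSystem G hG → ℝ≥0∞) :
    ∫⁻ x, f x ∂(cableMeasure G hG) =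
      ∑' e, ∫⁻ t in Icc (0 : ℝ) 1, f (cablePoint hG e t) := by
  rw [cableMeasure, lintegral_sum_measure]
  congr 1
  funext e
  rw [(measurableEmbedding_proj e).lintegral_map,
    ← unitInterval.measurePreserving_coe.lintegral_comp_emb unitInterval.measurableEmbedding_coe]
  refine lintegral_congr fun a => ?_
  rw [cablePoint_of_mem e a.2]

theorem integral_map_proj (f : CableSystem G hG → ℝ) (e : G.edgeSet) :
    ∫ x, f x ∂(Measure.map (proj hG e) volume) = ∫ t in (0 : ℝ)..1, onCable f e t := by
  rw [(measurableEmbedding_proj e).integral_map, intervalIntegral.integral_of_le zero_le_one,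
    ← integral_Icc_eq_integral_Ioc,
    ← unitInterval.measurePreserving_coe.integral_comp unitInterval.measurableEmbedding_coe]
  refine integral_congr_ae (ae_of_all _ fun a => ?_)
  show _ = f (cablePoint hG e a)
  rw [cablePoint_of_mem e a.2]

theorem aestronglyMeasurable_onCable {f : CableSystem G hG → ℝ}
    (hf : AEStronglyMeasurable f (cableMeasure G hG)) (e : G.edgeSet) :
    AEStronglyMeasurable (onCable f e) (volume.restrict (Icc 0 1)) :=
  (hf.mono_measure (map_cablePoint_le e)).comp_aemeasurable (continuous_cablePoint e).aemeasurable

theorem aestronglyMeasurable_of_onCable [Countable G.edgeSet] {f : CableSystem G hG → ℝ}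
    (hf : ∀ e, AEStronglyMeasurable (onCable f e) (volume.restrict (Icc 0 1))) :
    AEStronglyMeasurable f (cableMeasure G hG) := by
  rw [cableMeasure, aestronglyMeasurable_sum_measure_iff]
  intro e
  rw [(measurableEmbedding_proj e).aestronglyMeasurable_map_iff]
  have := (hf e).comp_measurePreserving unitInterval.measurePreserving_coe
  refine this.congr (ae_of_all _ fun a => ?_)
  show f (cablePoint hG e a) = _
  rw [cablePoint_of_mem e a.2]
  rfl

theorem eLpNorm_onCable_le {f : CableSystem G hG → ℝ}
    (hf : AEStronglyMeasurable f (cableMeasure G hG)) (e : G.edgeSet) (p : ℝ≥0∞) :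
    eLpNorm (onCable f e) p (volume.restrict (Icc 0 1)) ≤ eLpNorm f p (cableMeasure G hG) := by
  have := eLpNorm_map_measure (p := p) (hf.mono_measure (map_cablePoint_le e))
    (continuous_cablePoint e).aemeasurable
  exact this.symm.trans_le (eLpNorm_mono_measure _ (map_cablePoint_le e))

theorem memLp_onCable {f : CableSystem G hG → ℝ} {p : ℝ≥0∞} (hf : MemLp f p (cableMeasure G hG))
    (e : G.edgeSet) : MemLp (onCable f e) p (volume.restrict (Icc 0 1)) :=
  ⟨aestronglyMeasurable_onCable hf.1 e, (eLpNorm_onCable_le hf.1 e p).trans_lt hf.2⟩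

theorem intervalIntegrable_of_memLp {f : ℝ → ℝ} {p : ℝ≥0∞} (hp : 1 ≤ p)
    (hf : MemLp f p (volume.restrict (Icc 0 1))) {a b : ℝ} (ha : a ∈ Icc (0 : ℝ) 1)
    (hb : b ∈ Icc (0 : ℝ) 1) : IntervalIntegrable f volume a b := by
  have h : IntegrableOn f (Icc 0 1) := hf.integrable hp
  have h' : IntervalIntegrable f volume 0 1 :=
    (intervalIntegrable_iff_integrableOn_Icc_of_le zero_le_one).2 h
  refine h'.mono_set ?_
  rw [uIcc_of_le (zero_le_one' ℝ)]
  exact uIcc_subset_Icc ha hb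

instance : IsProbabilityMeasure (volume.restrict (Icc (0 : ℝ) 1)) := ⟨by simp⟩

theorem tendsto_intervalIntegral_of_L1 {f : ℝ → ℝ} {F : ℕ → ℝ → ℝ}
    (hf : MemLp f 1 (volume.restrict (Icc 0 1)))
    (hF : ∀ n, MemLp (F n) 1 (volume.restrict (Icc 0 1)))
    (h : Tendsto (fun n => eLpNorm (F n - f) 1 (volume.restrict (Icc 0 1))) atTop (𝓝 0))
    {a b : ℝ} (ha : a ∈ Icc (0 : ℝ) 1) (hb : b ∈ Icc (0 : ℝ) 1) :
    Tendsto (fun n => ∫ t in a..b, F n t) atTop (𝓝 (∫ t in a..b, f t)) := by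
  have key : ∀ c ∈ Icc (0 : ℝ) 1, ∀ d ∈ Icc (0 : ℝ) 1,
      Tendsto (fun n => ∫ t in Ioc c d, F n t) atTop (𝓝 (∫ t in Ioc c d, f t)) := by
    intro c hc d hd
    have := tendsto_setIntegral_of_L1' f hf.1
      (Eventually.of_forall fun n => (hF n).integrable le_rfl) h (Ioc c d)
    rwa [Measure.restrict_restrict_of_subset
      (Ioc_subset_Icc_self.trans (Icc_subset_Icc hc.1 hd.2))] at this
  exact (key a ha b hb).sub (key b hb a ha)

/-! ### The pointwise gradient -/

/-- A point in the interior of a cable has only one representative in `E × [0, 1]`. -/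
theorem out_cablePoint (e : G.edgeSet) {t : ℝ} (ht : t ∈ Ioo (0 : ℝ) 1) :
    Quotient.out (cablePoint hG e t) =
      (⟨e, ⟨t, Ioo_subset_Icc_self ht⟩⟩ : PrePoint G hG) := by
  set x : PrePoint G hG := ⟨e, ⟨t, Ioo_subset_Icc_self ht⟩⟩ with hx
  set y := Quotient.out (cablePoint hG e t) with hy
  have h1 : SeparationQuotient.mk y = SeparationQuotient.mk x := by
    rw [hy, cablePoint_of_mem e (Ioo_subset_Icc_self ht)]
    exact Quotient.out_eq _
  have h2 : dist x y = 0 := by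
    rw [← SeparationQuotient.dist_mk, h1, dist_self]
  change x.geodDist y = 0 at h2
  have he : x.edge = y.edge := by
    by_contra hne
    obtain ⟨i, j, hij⟩ := PrePoint.exists_geodDist_eq_via hne
    have h3 : 0 < x.offset i := by
      cases i
      · rw [PrePoint.offset_false]; exact ht.1
      · rw [PrePoint.offset_true]; exact sub_pos.2 ht.2
    have h4 := y.offset_nonneg j
    have h5 : (0 : ℝ) ≤ G.dist (x.endpoint i) (y.endpoint j) := Nat.cast_nonneg _
    rw [h2, PrePoint.via] at hij
    linarith
  rw [PrePoint.geodDist_of_edge_eq he, abs_eq_zero, sub_eq_zero] at h2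
  exact PrePoint.ext he.symm (Subtype.ext h2.symm)

theorem grad_cablePoint (u : CableSystem G hG → ℝ) (e : G.edgeSet) {t : ℝ}
    (ht : t ∈ Ioo (0 : ℝ) 1) : grad u (cablePoint hG e t) = deriv (onCable u e) t := by
  unfold grad
  rw [out_cablePoint e ht]

theorem ae_mem_Ioo : ∀ᵐ t ∂(volume.restrict (Icc (0 : ℝ) 1)), t ∈ Ioo (0 : ℝ) 1 := by
  rw [← restrict_Ioo_eq_restrict_Icc]
  exact ae_restrict_mem measurableSet_Ioo

theorem onCable_grad_ae (u : CableSystem G hG → ℝ) (e : G.edgeSet) :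
    onCable (grad u) e =ᵐ[volume.restrict (Icc (0 : ℝ) 1)] deriv (onCable u e) := by
  filter_upwards [ae_mem_Ioo] with t ht using grad_cablePoint u e ht

theorem aestronglyMeasurable_grad [Countable G.edgeSet] (u : CableSystem G hG → ℝ) :
    AEStronglyMeasurable (grad u) (cableMeasure G hG) :=
  aestronglyMeasurable_of_onCable fun e =>
    (stronglyMeasurable_deriv _).aestronglyMeasurable.congr (onCable_grad_ae u e).symm

/-- The fundamental theorem of calculus for core functions. The derivative need not be continuous,
but it exists everywhere and is essentially bounded, hence integrable. -/
theorem integral_onCable_grad [Countable G.edgeSet] {w : CableSystem G hG → ℝ}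
    (hw : w ∈ coreFunctions G hG) (e : G.edgeSet) {a b : ℝ} (ha : a ∈ Icc (0 : ℝ) 1)
    (hb : b ∈ Icc (0 : ℝ) 1) :
    ∫ t in a..b, onCable (grad w) e t = onCable w e b - onCable w e a := by
  wlog hab : a ≤ b generalizing a b
  · rw [intervalIntegral.integral_symm, this hb ha (le_of_not_ge hab), neg_sub]
  have hsub : Icc a b ⊆ Icc 0 1 := Icc_subset_Icc ha.1 hb.2
  have hmem : MemLp (onCable (grad w) e) ∞ (volume.restrict (Icc 0 1)) :=
    memLp_onCable ⟨aestronglyMeasurable_grad w, hw.2.2.2⟩ e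
  refine intervalIntegral.integral_eq_sub_of_hasDerivAt_of_le hab
    ((hw.2.2.1 e).continuousOn.mono hsub) (fun t ht => ?_)
    (intervalIntegrable_of_memLp le_top hmem ha hb)
  have ht' : t ∈ Ioo (0 : ℝ) 1 := ⟨ha.1.trans_lt ht.1, ht.2.trans_le hb.2⟩
  rw [onCable_apply, grad_cablePoint w e ht']
  exact ((hw.2.2.1 e).differentiableAt (Icc_mem_nhds ht'.1 ht'.2)).hasDerivAt

/-- A function with a gradient in the sense of the form domain has a representative that is, on
every cable, a primitive of the gradient. Being defined everywhere, it has values at the vertices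
that are common to all adjacent cables. -/
theorem HasEnergyGrad.exists_primitive [Countable G.edgeSet] {u g : CableSystem G hG → ℝ}
    (h : HasEnergyGrad u g) :
    ∃ v : CableSystem G hG → ℝ, v =ᵐ[cableMeasure G hG] u ∧
      ∀ e, ∀ a ∈ Icc (0 : ℝ) 1, ∀ b ∈ Icc (0 : ℝ) 1,
        ∫ t in a..b, onCable g e t = onCable v e b - onCable v e a := by
  obtain ⟨hu, hg, w, hw, hwu, hwg⟩ := h
  have hwm : ∀ n, AEStronglyMeasurable (w n) (cableMeasure G hG) := fun n =>
    (hw n).1.aestronglyMeasurable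
  obtain ⟨ns, hns, hlim⟩ := (tendstoInMeasure_of_tendsto_eLpNorm two_ne_zero hwm hu.1
    hwu).exists_seq_tendsto_ae
  have hint : ∀ e, ∀ a ∈ Icc (0 : ℝ) 1, ∀ b ∈ Icc (0 : ℝ) 1,
      Tendsto (fun n => onCable (w (ns n)) e b - onCable (w (ns n)) e a) atTop
        (𝓝 (∫ t in a..b, onCable g e t)) := by
    intro e a ha b hb
    have hL : Tendsto (fun n => eLpNorm (onCable (grad (w (ns n)) - g) e) 1
        (volume.restrict (Icc 0 1))) atTop (𝓝 0) := by
      refine tendsto_of_tendsto_of_tendsto_of_le_of_le tendsto_const_nhds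
        (hwg.comp hns.tendsto_atTop) (fun _ => zero_le) fun n => ?_
      have hm := (aestronglyMeasurable_grad (w (ns n))).sub hg.1
      exact (eLpNorm_le_eLpNorm_of_exponent_le one_le_two
        (aestronglyMeasurable_onCable hm e)).trans (eLpNorm_onCable_le hm e 2)
    have h1 : ∀ n, MemLp (onCable (grad (w (ns n))) e) 1 (volume.restrict (Icc 0 1)) := fun n =>
      (memLp_onCable ⟨aestronglyMeasurable_grad _, (hw (ns n)).2.2.2⟩ e).mono_exponent le_top
    refine (tendsto_intervalIntegral_of_L1 ((memLp_onCable hg e).mono_exponent one_le_two) h1 hL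
      ha hb).congr fun n => ?_
    exact integral_onCable_grad (hw (ns n)) e ha hb
  have hconv : ∀ x, ∃ l, Tendsto (fun n => w (ns n) x) atTop (𝓝 l) := by
    intro x
    obtain ⟨e, b, hb, rfl⟩ := exists_eq_cablePoint x
    obtain ⟨a, hlim', ha⟩ := ((ae_cablePoint e hlim).and ae_mem_Ioo).exists
    refine ⟨_, ((hint e a (Ioo_subset_Icc_self ha) b hb).add hlim').congr fun n => ?_⟩
    simp only [onCable_apply]
    ring
  choose v hv using hconv
  refine ⟨v, ?_, fun e a ha b hb => ?_⟩
  · filter_upwards [hlim] with x hx using tendsto_nhds_unique (hv x) hx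
  · exact tendsto_nhds_unique (hint e a ha b hb) ((hv _).sub (hv _))

theorem continuousOn_onCable_of_primitive {v g : CableSystem G hG → ℝ} {e : G.edgeSet}
    (hg : MemLp (onCable g e) 2 (volume.restrict (Icc 0 1)))
    (hv : ∀ a ∈ Icc (0 : ℝ) 1, ∀ b ∈ Icc (0 : ℝ) 1,
      ∫ t in a..b, onCable g e t = onCable v e b - onCable v e a) :
    ContinuousOn (onCable v e) (Icc 0 1) := by
  have h0 : (0 : ℝ) ∈ Icc (0 : ℝ) 1 := ⟨le_rfl, zero_le_one⟩
  have h1 : (1 : ℝ) ∈ Icc (0 : ℝ) 1 := ⟨zero_le_one, le_rfl⟩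
  have h := intervalIntegral.continuousOn_primitive_interval' (a := 0)
    (intervalIntegrable_of_memLp one_le_two hg h0 h1) left_mem_uIcc
  rw [uIcc_of_le (zero_le_one' ℝ)] at h
  refine (h.add (continuousOn_const (c := onCable v e 0))).congr fun t ht => ?_
  show _ = (∫ s in (0 : ℝ)..t, onCable g e s) + onCable v e 0
  rw [hv 0 h0 t ht, sub_add_cancel]

/-- The gradient of a function of the form domain is unique: the gradient is a closable
operator. -/
theorem HasEnergyGrad.unique [Countable G.edgeSet] {u g₁ g₂ : CableSystem G hG → ℝ}
    (h₁ : HasEnergyGrad u g₁) (h₂ : HasEnergyGrad u g₂) : g₁ =ᵐ[cableMeasure G hG] g₂ := by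
  obtain ⟨v₁, hu₁, hv₁⟩ := h₁.exists_primitive
  obtain ⟨v₂, hu₂, hv₂⟩ := h₂.exists_primitive
  refine ae_cableMeasure_iff.2 fun e => ?_
  have m₁ := memLp_onCable h₁.2.1 e
  have m₂ := memLp_onCable h₂.2.1 e
  have heq : EqOn (onCable v₁ e) (onCable v₂ e) (Icc 0 1) :=
    Measure.eqOn_Icc_of_ae_eq volume zero_ne_one (ae_cablePoint e (hu₁.trans hu₂.symm))
      (continuousOn_onCable_of_primitive m₁ (hv₁ e))
      (continuousOn_onCable_of_primitive m₂ (hv₂ e))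
  have h0 : (0 : ℝ) ∈ Icc (0 : ℝ) 1 := ⟨le_rfl, zero_le_one⟩
  have h1 : (1 : ℝ) ∈ Icc (0 : ℝ) 1 := ⟨zero_le_one, le_rfl⟩
  have d₁ := (intervalIntegrable_of_memLp one_le_two m₁ h0 h1).ae_hasDerivAt_integral
  have d₂ := (intervalIntegrable_of_memLp one_le_two m₂ h0 h1).ae_hasDerivAt_integral
  filter_upwards [ae_restrict_of_ae d₁, ae_restrict_of_ae d₂, ae_mem_Ioo] with t ht₁ ht₂ ht
  rw [uIcc_of_le (zero_le_one' ℝ)] at ht₁ ht₂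
  refine (ht₁ (Ioo_subset_Icc_self ht) 0 h0).unique
    ((ht₂ (Ioo_subset_Icc_self ht) 0 h0).congr_of_eventuallyEq ?_)
  filter_upwards [Icc_mem_nhds ht.1 ht.2] with s hs
  rw [hv₁ e 0 h0 s hs, hv₂ e 0 h0 s hs, heq hs, heq h0]

theorem hasEnergyGrad_energyGrad {u : CableSystem G hG → ℝ} (hu : u ∈ formDomain G hG) :
    HasEnergyGrad u (energyGrad u) := by
  have h : ∃ g, HasEnergyGrad u g := hu
  unfold energyGrad
  rw [dif_pos h]
  exact h.choose_spec

/-- A core function with square integrable gradient belongs to the form domain, with its pointwise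
gradient. -/
theorem hasEnergyGrad_of_mem_coreFunctions {w : CableSystem G hG → ℝ}
    (hw : w ∈ coreFunctions G hG) (h : MemLp w 2 (cableMeasure G hG))
    (h' : MemLp (grad w) 2 (cableMeasure G hG)) : HasEnergyGrad w (grad w) :=
  ⟨h, h', fun _ => w, fun _ => hw, by simp, by simp⟩

/-! ### Test functions -/

/-- A family of functions `ψ e` on the cables fits together to a Lipschitz function on `X`: they
take common values `k` at the vertices, and their derivatives have a common bound `L`. -/
structure Gluable (ψ : G.edgeSet → ℝ → ℝ) (k : V → ℝ) (L : ℝ≥0) : Prop where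
  source : ∀ e, ψ e 0 = k (source G e)
  target : ∀ e, ψ e 1 = k (target G e)
  differentiable : ∀ e, Differentiable ℝ (ψ e)
  deriv_le : ∀ e t, |deriv (ψ e) t| ≤ L

variable {ψ : G.edgeSet → ℝ → ℝ} {k : V → ℝ} {L : ℝ≥0}

theorem Gluable.abs_apply_sub_le (h : Gluable ψ k L) (e : G.edgeSet) (s t : ℝ) :
    |ψ e s - ψ e t| ≤ L * |s - t| := by
  have := lipschitzWith_of_nnnorm_deriv_le (C := L) (h.differentiable e) (fun t => by
    rw [← NNReal.coe_le_coe, coe_nnnorm]; exact h.deriv_le e t)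
  simpa [Real.dist_eq] using this.dist_le_mul s t

theorem Gluable.abs_vertex_sub_le (h : Gluable ψ k L) (v w : V) (p : G.Walk v w) :
    |k v - k w| ≤ L * p.length := by
  induction p with
  | nil => simp
  | @cons a b c hab p ih =>
    have h1 : |k a - k b| ≤ L := by
      have h2 := h.abs_apply_sub_le ⟨s(a, b), hab⟩ 0 1
      rw [h.source, h.target] at h2
      have h3 := mk_source_target G ⟨s(a, b), hab⟩
      rcases Sym2.eq_iff.1 h3 with ⟨h4, h5⟩ | ⟨h4, h5⟩
      · rw [h4, h5] at h2; simpa using h2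
      · rw [h4, h5, abs_sub_comm] at h2; simpa using h2
    have h2 := abs_sub_le (k a) (k b) (k c)
    rw [SimpleGraph.Walk.length_cons]
    push_cast
    linarith

theorem Gluable.abs_vertex_sub_le_dist (hG : G.Connected) (h : Gluable ψ k L) (v w : V) :
    |k v - k w| ≤ L * G.dist v w := by
  obtain ⟨p, hp⟩ := hG.exists_walk_length_eq_dist v w
  rw [← hp]
  exact h.abs_vertex_sub_le v w p

/-- The function on `E × [0, 1]` which is given by `ψ e` on the cable `e`. -/
def preGlue (hG : G.Connected) (ψ : G.edgeSet → ℝ → ℝ) (x : PrePoint G hG) : ℝ := ψ x.edge x.pos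

theorem Gluable.abs_sub_endpoint_le (h : Gluable ψ k L) (x : PrePoint G hG) (i : Bool) :
    |preGlue hG ψ x - k (x.endpoint i)| ≤ L * x.offset i := by
  cases i
  · have := h.abs_apply_sub_le x.edge x.pos 0
    rw [h.source, sub_zero] at this
    exact this
  · have := h.abs_apply_sub_le x.edge x.pos 1
    rw [h.target] at this
    exact this

theorem Gluable.lipschitzWith (h : Gluable ψ k L) : LipschitzWith L (preGlue hG ψ) := by
  refine LipschitzWith.of_dist_le_mul fun x y => ?_
  change |preGlue hG ψ x - preGlue hG ψ y| ≤ L * x.geodDist y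
  by_cases he : x.edge = y.edge
  · rw [PrePoint.geodDist_of_edge_eq he, preGlue, preGlue, ← he]
    exact h.abs_apply_sub_le _ _ _
  · obtain ⟨i, j, hij⟩ := PrePoint.exists_geodDist_eq_via he
    have h1 := h.abs_sub_endpoint_le x i
    have h2 := h.abs_sub_endpoint_le y j
    have h3 := h.abs_vertex_sub_le_dist hG (x.endpoint i) (y.endpoint j)
    rw [abs_sub_comm] at h2
    rw [hij, PrePoint.via, mul_add, mul_add]
    have h4 := abs_sub_le (preGlue hG ψ x) (k (x.endpoint i)) (preGlue hG ψ y)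
    have h5 := abs_sub_le (k (x.endpoint i)) (k (y.endpoint j)) (preGlue hG ψ y)
    linarith

/-- The function on `X` which is given by `ψ e` on the cable `e`. -/
def glue (hG : G.Connected) (h : Gluable ψ k L) : CableSystem G hG → ℝ :=
  SeparationQuotient.lift (preGlue hG ψ) fun _ _ hxy =>
    (hxy.map h.lipschitzWith.continuous).eq

theorem continuous_glue (h : Gluable ψ k L) : Continuous (glue hG h) :=
  SeparationQuotient.continuous_lift h.lipschitzWith.continuous

theorem glue_cablePoint (h : Gluable ψ k L) (e : G.edgeSet) {t : ℝ} (ht : t ∈ Icc (0 : ℝ) 1) :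
    glue hG h (cablePoint hG e t) = ψ e t := by
  rw [cablePoint_of_mem e ht]
  rfl

theorem onCable_glue_eqOn (h : Gluable ψ k L) (e : G.edgeSet) :
    EqOn (onCable (glue hG h) e) (ψ e) (Icc 0 1) := fun _ ht => glue_cablePoint h e ht

theorem grad_glue_cablePoint (h : Gluable ψ k L) (e : G.edgeSet) {t : ℝ}
    (ht : t ∈ Ioo (0 : ℝ) 1) : grad (glue hG h) (cablePoint hG e t) = deriv (ψ e) t := by
  rw [grad_cablePoint _ e ht]
  refine Filter.EventuallyEq.deriv_eq ?_
  filter_upwards [Icc_mem_nhds ht.1 ht.2] with s hs using onCable_glue_eqOn h e hs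

/-- The union of the closed subsets `S e` of finitely many cables is compact. -/
theorem isCompact_iUnion_proj (F : Finset G.edgeSet) {S : G.edgeSet → Set ℝ}
    (hS : ∀ e ∈ F, IsCompact (S e)) : IsCompact (⋃ e ∈ F, cablePoint hG e '' S e) :=
  F.isCompact_biUnion fun e he => (hS e he).image (continuous_cablePoint e)

theorem tsupport_glue_subset (h : Gluable ψ k L) (F : Finset G.edgeSet)
    (S : G.edgeSet → Set ℝ) (hF : ∀ e ∉ F, ψ e = 0) (hS : ∀ e ∈ F, IsCompact (S e))
    (hψS : ∀ e ∈ F, ∀ t ∈ Icc (0 : ℝ) 1, ψ e t ≠ 0 → t ∈ S e) :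
    tsupport (glue hG h) ⊆ ⋃ e ∈ F, cablePoint hG e '' S e := by
  refine closure_minimal (fun x hx => ?_) (isCompact_iUnion_proj F hS).isClosed
  obtain ⟨e, t, ht, rfl⟩ := exists_eq_cablePoint x
  rw [Function.mem_support, glue_cablePoint h e ht] at hx
  have he : e ∈ F := by
    by_contra he
    exact hx (by rw [hF e he]; rfl)
  exact mem_iUnion₂.2 ⟨e, he, t, hψS e he t ht hx, rfl⟩

theorem hasCompactSupport_glue (h : Gluable ψ k L) (F : Finset G.edgeSet)
    (S : G.edgeSet → Set ℝ) (hF : ∀ e ∉ F, ψ e = 0) (hS : ∀ e ∈ F, IsCompact (S e))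
    (hψS : ∀ e ∈ F, ∀ t ∈ Icc (0 : ℝ) 1, ψ e t ≠ 0 → t ∈ S e) :
    HasCompactSupport (glue hG h) :=
  (isCompact_iUnion_proj F hS).of_isClosed_subset (isClosed_tsupport _)
    (tsupport_glue_subset h F S hF hS hψS)

theorem ae_abs_grad_glue_le [Countable G.edgeSet] (h : Gluable ψ k L) :
    ∀ᵐ x ∂(cableMeasure G hG), ‖grad (glue hG h) x‖ ≤ L := by
  refine ae_cableMeasure_iff.2 fun e => ?_
  filter_upwards [ae_mem_Ioo] with t ht
  rw [grad_glue_cablePoint h e ht]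
  exact h.deriv_le e t

theorem hasCompactSupport_glue_of_finite (h : Gluable ψ k L) (F : Finset G.edgeSet)
    (hF : ∀ e ∉ F, ψ e = 0) : HasCompactSupport (glue hG h) :=
  hasCompactSupport_glue h F (fun _ => Icc 0 1) hF (fun _ _ => isCompact_Icc)
    fun _ _ _ ht _ => ht

theorem glue_mem_coreFunctions [Countable G.edgeSet] (h : Gluable ψ k L) (F : Finset G.edgeSet)
    (hF : ∀ e ∉ F, ψ e = 0) : glue hG h ∈ coreFunctions G hG := by
  refine ⟨continuous_glue h, hasCompactSupport_glue_of_finite h F hF, fun e => ?_, ?_⟩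
  · exact (h.differentiable e).differentiableOn.congr (onCable_glue_eqOn h e)
  · refine (eLpNorm_le_of_ae_bound (ae_abs_grad_glue_le h)).trans_lt ?_
    simp

theorem memLp_of_bound_of_finite [Countable G.edgeSet] {f : CableSystem G hG → ℝ}
    (hf : AEStronglyMeasurable f (cableMeasure G hG)) (C : ℝ)
    (hC : ∀ᵐ x ∂(cableMeasure G hG), ‖f x‖ ≤ C) (F : Finset G.edgeSet)
    (hF : ∀ e ∉ F, ∀ t ∈ Ioo (0 : ℝ) 1, f (cablePoint hG e t) = 0) :
    MemLp f 2 (cableMeasure G hG) := by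
  refine ⟨hf, ?_⟩
  rw [eLpNorm_lt_top_iff_lintegral_rpow_enorm_lt_top two_ne_zero ENNReal.ofNat_ne_top,
    lintegral_cableMeasure, tsum_eq_sum (s := F)]
  · refine ENNReal.sum_lt_top.2 fun e _ => ?_
    have : ∀ᵐ t ∂(volume.restrict (Icc (0 : ℝ) 1)),
        ‖f (cablePoint hG e t)‖ₑ ^ (2 : ℝ≥0∞).toReal ≤
          ENNReal.ofReal C ^ (2 : ℝ≥0∞).toReal := by
      filter_upwards [ae_cablePoint e hC] with t ht
      gcongr
      rw [← ofReal_norm]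
      exact ENNReal.ofReal_le_ofReal ht
    refine (lintegral_mono_ae this).trans_lt ?_
    simp
  · intro e he
    rw [lintegral_eq_zero_of_ae_eq_zero]
    filter_upwards [ae_mem_Ioo] with t ht
    simp [hF e he t ht]

theorem hasEnergyGrad_glue [Countable G.edgeSet] (h : Gluable ψ k L) (F : Finset G.edgeSet)
    (hF : ∀ e ∉ F, ψ e = 0) : HasEnergyGrad (glue hG h) (grad (glue hG h)) := by
  have hc := glue_mem_coreFunctions (hG := hG) h F hF
  refine hasEnergyGrad_of_mem_coreFunctions hc ?_ ?_
  · obtain ⟨C, hC⟩ := hc.1.bounded_above_of_compact_support hc.2.1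
    refine memLp_of_bound_of_finite hc.1.aestronglyMeasurable C (ae_of_all _ hC) F ?_
    intro e he t ht
    rw [glue_cablePoint h e (Ioo_subset_Icc_self ht), hF e he]
    rfl
  · refine memLp_of_bound_of_finite (aestronglyMeasurable_grad _) L (ae_abs_grad_glue_le h) F ?_
    intro e he t ht
    rw [grad_glue_cablePoint h e ht, hF e he]
    exact deriv_const t 0

/-- The energy of a function of the form domain and a test function is a finite sum of integrals
over cables. -/
theorem energy_glue [Countable G.edgeSet] {u : CableSystem G hG → ℝ}
    (hu : u ∈ formDomain G hG) (h : Gluable ψ k L) (F : Finset G.edgeSet)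
    (hF : ∀ e ∉ F, ψ e = 0) :
    energy u (glue hG h) =
      ∑ e ∈ F, ∫ t in (0 : ℝ)..1, onCable (energyGrad u) e t * deriv (ψ e) t := by
  have hg := hasEnergyGrad_glue (hG := hG) h F hF
  have hae : energyGrad (glue hG h) =ᵐ[cableMeasure G hG] grad (glue hG h) :=
    (hasEnergyGrad_energyGrad ⟨_, hg⟩).unique hg
  have h1 : energy u (glue hG h) =
      ∫ x, energyGrad u x * grad (glue hG h) x ∂(cableMeasure G hG) := by
    refine integral_congr_ae ?_
    filter_upwards [hae] with x hx
    rw [hx]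
  have hint : Integrable (fun x => energyGrad u x * grad (glue hG h) x) (cableMeasure G hG) :=
    (hasEnergyGrad_energyGrad hu).2.1.integrable_mul hg.2.1
  have hsum := hasSum_integral_measure hint
  have h2 : ∀ e : G.edgeSet, ∫ x, energyGrad u x * grad (glue hG h) x
      ∂(Measure.map (proj hG e) volume) =
      ∫ t in (0 : ℝ)..1, onCable (energyGrad u) e t * deriv (ψ e) t := by
    intro e
    rw [integral_map_proj]
    refine intervalIntegral.integral_congr_ae_restrict ?_
    rw [uIoc_of_le (zero_le_one' ℝ), restrict_Ioc_eq_restrict_Icc]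
    filter_upwards [ae_mem_Ioo] with t ht
    rw [onCable_apply, grad_glue_cablePoint h e ht, onCable_apply]
  rw [h1]
  refine hsum.unique ?_
  simp_rw [h2]
  refine hasSum_sum_of_ne_finset_zero fun e he => ?_
  have : deriv (ψ e) = 0 := by
    rw [hF e he]
    funext t
    exact deriv_const t 0
  simp [this]

theorem IsHarmonicIn.sum_integral_eq_zero [Countable G.edgeSet] {u : CableSystem G hG → ℝ}
    {D : Set (CableSystem G hG)} (hu : IsHarmonicIn u D) (h : Gluable ψ k L)
    (F : Finset G.edgeSet) (S : G.edgeSet → Set ℝ)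
    (hF : ∀ e ∉ F, ψ e = 0) (hS : ∀ e ∈ F, IsCompact (S e))
    (hψS : ∀ e ∈ F, ∀ t ∈ Icc (0 : ℝ) 1, ψ e t ≠ 0 → t ∈ S e)
    (hD : ∀ e ∈ F, ∀ t ∈ S e, cablePoint hG e t ∈ D) :
    ∑ e ∈ F, ∫ t in (0 : ℝ)..1, onCable (energyGrad u) e t * deriv (ψ e) t = 0 := by
  rw [← energy_glue hu.1 h F hF]
  refine hu.2 _ ⟨_, hasEnergyGrad_glue h F hF⟩ (continuous_glue h)
    (hasCompactSupport_glue_of_finite h F hF)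
    ((tsupport_glue_subset h F S hF hS hψS).trans ?_)
  refine iUnion₂_subset fun e he => ?_
  rintro _ ⟨t, ht, rfl⟩
  exact hD e he t ht

/-! ### Harmonic functions along a cable -/

/-- Testing harmonicity with a primitive of `θ`, supported in the interior of one cable. -/
theorem IsHarmonicIn.integral_mul_eq_zero [Countable G.edgeSet] {u : CableSystem G hG → ℝ}
    {D : Set (CableSystem G hG)} (hu : IsHarmonicIn u D) (e : G.edgeSet) {a b : ℝ}
    (ha : 0 ≤ a) (hb : b ≤ 1) (hD : ∀ t ∈ Icc a b, cablePoint hG e t ∈ D)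
    {θ : ℝ → ℝ} (hθ : Continuous θ) (hθs : ∀ t ∉ Ioo a b, θ t = 0)
    (hθ0 : ∫ t in a..b, θ t = 0) :
    ∫ t in (0 : ℝ)..1, onCable (energyGrad u) e t * θ t = 0 := by
  classical
  have hbd : ∃ C : ℝ, ∀ t, ‖θ t‖ ≤ C :=
    hθ.bounded_above_of_compact_support (HasCompactSupport.of_support_subset_isCompact
      (isCompact_Icc (a := a) (b := b)) fun t ht => Ioo_subset_Icc_self (by
        by_contra h
        exact ht (hθs t h)))
  obtain ⟨C, hC⟩ := hbd
  set Ψ : ℝ → ℝ := fun t => ∫ s in a..t, θ s with hΨ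
  have hd : ∀ t, HasDerivAt Ψ (θ t) t := fun t => hθ.integral_hasStrictDerivAt a t |>.hasDerivAt
  have hleft : ∀ t ≤ a, Ψ t = 0 := by
    intro t ht
    have : ∀ s ∈ uIcc a t, θ s = 0 := fun s hs => hθs s fun h => by
      rw [uIcc_of_ge ht] at hs
      exact absurd hs.2 (not_le.2 h.1)
    rw [hΨ]
    simp only
    rw [intervalIntegral.integral_congr this, intervalIntegral.integral_zero]
  have hright : ∀ t, b ≤ t → Ψ t = 0 := by
    intro t ht
    have : ∀ s ∈ uIcc b t, θ s = 0 := fun s hs => hθs s fun h => by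
      rw [uIcc_of_le ht] at hs
      exact absurd hs.1 (not_le.2 h.2)
    rw [hΨ]
    simp only
    rw [← intervalIntegral.integral_add_adjacent_intervals (hθ.intervalIntegrable a b)
      (hθ.intervalIntegrable b t), hθ0, intervalIntegral.integral_congr this,
      intervalIntegral.integral_zero, add_zero]
  set ψ : G.edgeSet → ℝ → ℝ := fun e' => if e' = e then Ψ else 0 with hψ
  have hglue : Gluable ψ (fun _ => 0) (Real.toNNReal C) := by
    have hcase : ∀ e', ψ e' = Ψ ∨ ψ e' = 0 := by
      intro e'
      by_cases h : e' = e
      · left; simp [hψ, h]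
      · right; simp [hψ, h]
    constructor
    · intro e'
      rcases hcase e' with h | h <;> rw [h]
      exacts [hleft 0 ha, rfl]
    · intro e'
      rcases hcase e' with h | h <;> rw [h]
      exacts [hright 1 hb, rfl]
    · intro e'
      rcases hcase e' with h | h <;> rw [h]
      exacts [fun t => (hd t).differentiableAt, differentiable_const 0]
    · intro e' t
      rcases hcase e' with h | h <;> rw [h]
      · rw [(hd t).deriv]
        exact (hC t).trans (Real.le_coe_toNNReal C)
      · rw [show deriv (0 : ℝ → ℝ) t = 0 from deriv_const t 0, abs_zero]
        exact NNReal.coe_nonneg _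
  have hψe : ψ e = Ψ := by simp [hψ]
  have key := hu.sum_integral_eq_zero hglue {e} (fun _ => Icc a b)
    (fun e' he' => by
      have : e' ≠ e := by simpa using he'
      simp [hψ, this])
    (fun _ _ => isCompact_Icc)
    (fun e' he' t _ hne => by
      rw [Finset.mem_singleton.1 he', hψe] at hne
      by_contra hcon
      rw [mem_Icc, not_and_or, not_le, not_le] at hcon
      rcases hcon with h | h
      · exact hne (hleft t h.le)
      · exact hne (hright t h.le))
    (fun e' he' t ht => by
      rw [Finset.mem_singleton.1 he']
      exact hD t ht)
  rw [Finset.sum_singleton, hψe] at key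
  simpa only [(hd _).deriv] using key

/-- The gradient of a harmonic function is constant along a piece of a cable. -/
theorem IsHarmonicIn.exists_grad_eq_const [Countable G.edgeSet] {u : CableSystem G hG → ℝ}
    {D : Set (CableSystem G hG)} (hu : IsHarmonicIn u D) (e : G.edgeSet) {a b : ℝ}
    (ha : 0 ≤ a) (hab : a < b) (hb : b ≤ 1) (hD : ∀ t ∈ Icc a b, cablePoint hG e t ∈ D) :
    ∃ s : ℝ, ∀ᵐ t, t ∈ Ioo a b → onCable (energyGrad u) e t = s := by
  set g := onCable (energyGrad u) e with hgdef
  have h0 : (0 : ℝ) ∈ Icc (0 : ℝ) 1 := ⟨le_rfl, zero_le_one⟩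
  have h1 : (1 : ℝ) ∈ Icc (0 : ℝ) 1 := ⟨zero_le_one, le_rfl⟩
  have hmem : MemLp g 2 (volume.restrict (Icc 0 1)) :=
    memLp_onCable (hasEnergyGrad_energyGrad hu.1).2.1 e
  have hgi : IntervalIntegrable g volume 0 1 := intervalIntegrable_of_memLp one_le_two hmem h0 h1
  have hsub : ∀ {f : ℝ → ℝ}, (∀ t ∉ Ioo a b, f t = 0) → ∫ t in a..b, f t = ∫ t, f t := by
    intro f hfs
    rw [intervalIntegral.integral_of_le hab.le]
    refine setIntegral_eq_integral_of_forall_compl_eq_zero fun t ht => hfs t fun h => ht ?_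
    exact Ioo_subset_Ioc_self h
  -- A normalized bump function on the interval.
  obtain ⟨ρ, hρ, hρs, hρ1⟩ : ∃ ρ : ℝ → ℝ, Continuous ρ ∧ (∀ t ∉ Ioo a b, ρ t = 0) ∧
      ∫ t in a..b, ρ t = 1 := by
    have hc : Continuous fun t : ℝ => max 0 ((t - a) * (b - t)) := by fun_prop
    have hpos : 0 < ∫ t in a..b, max 0 ((t - a) * (b - t)) := by
      refine intervalIntegral.intervalIntegral_pos_of_pos_on (hc.intervalIntegrable a b)
        (fun t ht => ?_) hab
      exact lt_max_of_lt_right (mul_pos (sub_pos.2 ht.1) (sub_pos.2 ht.2))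
    refine ⟨fun t => (∫ t in a..b, max 0 ((t - a) * (b - t)))⁻¹ * max 0 ((t - a) * (b - t)),
      continuous_const.mul hc, fun t ht => ?_, ?_⟩
    · have : (t - a) * (b - t) ≤ 0 := by
        rw [mem_Ioo, not_and_or, not_lt, not_lt] at ht
        rcases ht with h | h <;> nlinarith
      simp only [max_eq_left this, mul_zero]
    · rw [intervalIntegral.integral_const_mul, inv_mul_cancel₀ hpos.ne']
  set s := ∫ t in (0 : ℝ)..1, g t * ρ t with hs
  refine ⟨s, ?_⟩
  have hloc : LocallyIntegrableOn (fun t => g t - s) (Ioo a b) := by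
    have hI : IntegrableOn (fun t => g t - s) (Icc 0 1) :=
      (hmem.integrable one_le_two).sub (integrable_const s)
    exact (hI.mono_set (Ioo_subset_Icc_self.trans (Icc_subset_Icc ha hb))).locallyIntegrableOn
  have := isOpen_Ioo.ae_eq_zero_of_integral_contDiff_smul_eq_zero hloc ?_
  · filter_upwards [this] with t ht hmem using sub_eq_zero.1 (ht hmem)
  intro η hη _ hηs
  have hηc : Continuous η := hη.continuous
  have hη0 : ∀ t ∉ Ioo a b, η t = 0 := fun t ht =>
    image_eq_zero_of_notMem_tsupport fun h => ht (hηs h)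
  set c := ∫ t in a..b, η t with hc
  have hcρ : Continuous fun t => c * ρ t := continuous_const.mul hρ
  have key := hu.integral_mul_eq_zero e ha hb hD (θ := fun t => η t - c * ρ t)
    (hηc.sub hcρ) (fun t ht => by simp [hη0 t ht, hρs t ht]) (by
      rw [intervalIntegral.integral_sub (hηc.intervalIntegrable _ _)
        (hcρ.intervalIntegrable _ _), intervalIntegral.integral_const_mul,
        hρ1, mul_one, sub_self])
  have hI : ∫ t, η t • (g t - s) = ∫ t in (0 : ℝ)..1, η t * (g t - s) := by
    rw [intervalIntegral.integral_of_le zero_le_one]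
    refine (setIntegral_eq_integral_of_forall_compl_eq_zero fun t ht => ?_).symm
    rw [hη0 t fun h => ht ⟨ha.trans_lt h.1, h.2.le.trans hb⟩, zero_smul]
  have hη1 : ∫ t in (0 : ℝ)..1, η t = c := by
    rw [hc, hsub hη0, intervalIntegral.integral_of_le zero_le_one]
    exact setIntegral_eq_integral_of_forall_compl_eq_zero fun t ht =>
      hη0 t fun h => ht ⟨ha.trans_lt h.1, h.2.le.trans hb⟩
  have i1 : IntervalIntegrable (fun t => g t * η t) volume 0 1 :=
    hgi.mul_continuousOn hηc.continuousOn
  have i2 : IntervalIntegrable (fun t => g t * ρ t) volume 0 1 :=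
    hgi.mul_continuousOn hρ.continuousOn
  have e1 : ∫ t in (0 : ℝ)..1, g t * (η t - c * ρ t) =
      (∫ t in (0 : ℝ)..1, g t * η t) - c * s := by
    rw [hs, ← intervalIntegral.integral_const_mul, ← intervalIntegral.integral_sub i1
      (i2.const_mul c)]
    congr 1
    funext t
    ring
  have e2 : ∫ t in (0 : ℝ)..1, η t * (g t - s) = (∫ t in (0 : ℝ)..1, g t * η t) - c * s := by
    rw [← hη1, ← intervalIntegral.integral_mul_const, ← intervalIntegral.integral_sub i1
      ((hηc.intervalIntegrable 0 1).mul_const s)]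
    congr 1
    funext t
    ring
  rw [hI, e2, ← e1]
  exact key

/-! ### Vertices -/

/-- The end points of two cables at a common vertex are the same point of `X`. -/
theorem mk_eq_mk_of_endpoint {x y : PrePoint G hG} {i j : Bool} (hx : x.offset i = 0)
    (hy : y.offset j = 0) (h : x.endpoint i = y.endpoint j) :
    (SeparationQuotient.mk x : CableSystem G hG) = SeparationQuotient.mk y := by
  rw [SeparationQuotient.mk_eq_mk, Metric.inseparable_iff]
  refine le_antisymm ?_ dist_nonneg
  refine (PrePoint.geodDist_le_via x y i j).trans ?_
  rw [PrePoint.via, hx, hy, h, SimpleGraph.dist_self]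
  simp

/-- The restriction of a function on `X` to the vertices. -/
theorem exists_vertex_values (v : CableSystem G hG → ℝ) :
    ∃ h : V → ℝ, ∀ e, onCable v e 0 = h (source G e) ∧ onCable v e 1 = h (target G e) := by
  classical
  refine ⟨fun x => if hx : ∃ y : PrePoint G hG, ∃ i, y.offset i = 0 ∧ y.endpoint i = x then
    v (SeparationQuotient.mk hx.choose) else 0, fun e => ⟨?_, ?_⟩⟩
  · set z : PrePoint G hG := ⟨e, ⟨0, le_rfl, zero_le_one⟩⟩
    have hz : ∃ y : PrePoint G hG, ∃ i, y.offset i = 0 ∧ y.endpoint i = source G e :=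
      ⟨z, false, PrePoint.offset_false z, rfl⟩
    simp only [dif_pos hz]
    rw [onCable_apply, cablePoint_of_mem e ⟨le_rfl, zero_le_one⟩]
    obtain ⟨i, h1, h2⟩ := hz.choose_spec
    exact congrArg v (mk_eq_mk_of_endpoint (x := z) (i := false) (PrePoint.offset_false z) h1
      h2.symm)
  · set z : PrePoint G hG := ⟨e, ⟨1, zero_le_one, le_rfl⟩⟩
    have hz1 : z.offset true = 0 := (PrePoint.offset_true z).trans (sub_self 1)
    have hz : ∃ y : PrePoint G hG, ∃ i, y.offset i = 0 ∧ y.endpoint i = target G e :=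
      ⟨z, true, hz1, rfl⟩
    simp only [dif_pos hz]
    rw [onCable_apply, cablePoint_of_mem e ⟨zero_le_one, le_rfl⟩]
    obtain ⟨i, h1, h2⟩ := hz.choose_spec
    exact congrArg v (mk_eq_mk_of_endpoint (x := z) (i := true) hz1 h1 h2.symm)

/-- Kirchhoff's law: the values of a harmonic function at the vertices satisfy the discrete
Laplace equation. -/
theorem IsHarmonicIn.sum_sub_eq_zero [Countable G.edgeSet] {u v : CableSystem G hG → ℝ}
    {D : Set (CableSystem G hG)} (hu : IsHarmonicIn u D)
    (hv : ∀ e, ∀ a ∈ Icc (0 : ℝ) 1, ∀ b ∈ Icc (0 : ℝ) 1,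
      ∫ t in a..b, onCable (energyGrad u) e t = onCable v e b - onCable v e a)
    {h : V → ℝ} (hh : ∀ e, onCable v e 0 = h (source G e) ∧ onCable v e 1 = h (target G e))
    (x : V) (N : Finset V) (hN : ∀ y, y ∈ N ↔ G.Adj x y)
    (hD : ∀ e : G.edgeSet, x ∈ e.1 → ∀ t ∈ Icc (0 : ℝ) 1, cablePoint hG e t ∈ D) :
    ∑ y ∈ N, (h y - h x) = 0 := by
  classical
  set k : V → ℝ := fun y => if y = x then 1 else 0 with hk
  have hk0 : ∀ y, k y = 0 ∨ k y = 1 := fun y => by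
    by_cases hy : y = x
    · right; simp [hk, hy]
    · left; simp [hk, hy]
  set ψ : G.edgeSet → ℝ → ℝ := fun e t =>
    k (source G e) + t * (k (target G e) - k (source G e)) with hψ
  have hd : ∀ e t, HasDerivAt (ψ e) (k (target G e) - k (source G e)) t := fun e t => by
    have := ((hasDerivAt_id t).mul_const (k (target G e) - k (source G e))).const_add
      (k (source G e))
    rwa [one_mul] at this
  have hglue : Gluable ψ k 1 := by
    refine ⟨fun e => by simp [hψ], fun e => by simp [hψ], fun e t => (hd e t).differentiableAt,
      fun e t => ?_⟩
    rw [(hd e t).deriv]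
    rcases hk0 (source G e) with h1 | h1 <;> rcases hk0 (target G e) with h2 | h2 <;>
      rw [h1, h2] <;> simp
  set E : {y // y ∈ N} → G.edgeSet := fun y => ⟨s(x, y.1), (hN y.1).1 y.2⟩ with hE
  have hEinj : Function.Injective E := by
    intro y z hyz
    have h1 : s(x, y.1) = s(x, z.1) := congrArg Subtype.val hyz
    exact Subtype.ext (Sym2.congr_right.1 h1)
  set F : Finset G.edgeSet := N.attach.image E with hF
  have hmemF : ∀ e : G.edgeSet, x ∈ e.1 → e ∈ F := by
    intro e he
    obtain ⟨y, hy⟩ := Sym2.mem_iff_exists.1 he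
    have hadj : G.Adj x y := by
      have := e.2
      rwa [hy] at this
    exact Finset.mem_image.2 ⟨⟨y, (hN y).2 hadj⟩, Finset.mem_attach _ _, Subtype.ext hy.symm⟩
  have key := hu.sum_integral_eq_zero hglue F (fun _ => Icc 0 1)
    (fun e he => by
      have h1 : k (source G e) = 0 := by
        rw [hk]
        refine if_neg fun h2 => he (hmemF e ?_)
        rw [← mk_source_target G e, h2]
        exact Sym2.mem_mk_left _ _
      have h3 : k (target G e) = 0 := by
        rw [hk]
        refine if_neg fun h2 => he (hmemF e ?_)
        rw [← mk_source_target G e, h2]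
        exact Sym2.mem_mk_right _ _
      funext t
      simp [hψ, h1, h3])
    (fun _ _ => isCompact_Icc) (fun _ _ t ht _ => ht)
    (fun e he t ht => by
      obtain ⟨y, -, rfl⟩ := Finset.mem_image.1 he
      exact hD _ (Sym2.mem_mk_left _ _) t ht)
  rw [hF, Finset.sum_image hEinj.injOn] at key
  have hterm : ∀ y : {y // y ∈ N}, ∫ t in (0 : ℝ)..1, onCable (energyGrad u) (E y) t *
      deriv (ψ (E y)) t = -(h y.1 - h x) := by
    intro y
    have hne : y.1 ≠ x := ((hN y.1).1 y.2).ne'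
    simp only [(hd _ _).deriv]
    rw [intervalIntegral.integral_mul_const, hv (E y) 0 ⟨le_rfl, zero_le_one⟩ 1
      ⟨zero_le_one, le_rfl⟩, (hh (E y)).1, (hh (E y)).2]
    rcases Sym2.eq_iff.1 (mk_source_target G (E y)) with ⟨h4, h5⟩ | ⟨h4, h5⟩ <;>
      rw [h4, h5] <;> simp [hk, hne]
  simp only [hterm, Finset.sum_neg_distrib, neg_eq_zero] at key
  rwa [Finset.sum_attach N (fun y => h y - h x)] at key

/-! ### Slopes and masses -/

/-- The contributions of pieces of finitely many cables to an integral over `D`. -/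
theorem sum_setLIntegral_le {D : Set (CableSystem G hG)} (hDm : MeasurableSet D)
    (f : CableSystem G hG → ℝ≥0∞) (F : Finset G.edgeSet) {J : Set ℝ} (hJ : J ⊆ Icc 0 1)
    (hJm : MeasurableSet J) (hD : ∀ e ∈ F, ∀ t ∈ J, cablePoint hG e t ∈ D) :
    ∑ e ∈ F, ∫⁻ t in J, f (cablePoint hG e t) ≤ ∫⁻ x in D, f x ∂(cableMeasure G hG) := by
  rw [← lintegral_indicator hDm, lintegral_cableMeasure]
  refine le_trans (Finset.sum_le_sum fun e he => ?_) (ENNReal.sum_le_tsum F)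
  refine le_trans (le_of_eq ?_) (lintegral_mono_set hJ)
  refine setLIntegral_congr_fun hJm fun t ht => ?_
  simp only [indicator_of_mem (hD e he t ht)]

/-- The integral of `|u|` over `D` may be computed with any representative `v` of `u`. -/
theorem ofReal_setIntegral_abs_eq {D : Set (CableSystem G hG)} {u v : CableSystem G hG → ℝ}
    (hI : IntegrableOn u D (cableMeasure G hG)) (huv : v =ᵐ[cableMeasure G hG] u) :
    ENNReal.ofReal (∫ x in D, |u x| ∂(cableMeasure G hG)) =
      ∫⁻ x in D, ‖v x‖ₑ ∂(cableMeasure G hG) := by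
  have h1 := ofReal_integral_norm_eq_lintegral_enorm hI
  simp only [Real.norm_eq_abs] at h1
  rw [h1]
  refine lintegral_congr_ae (ae_restrict_of_ae ?_)
  filter_upwards [huv] with x hx
  rw [hx]

/-- If a representative of `u` takes the same constant value on finitely many cables in `D`, then
this value is controlled by the `L¹` norm of `u` on `D`, divided by the number of cables. -/
theorem card_mul_abs_le {D : Set (CableSystem G hG)} (hDm : MeasurableSet D)
    {u v : CableSystem G hG → ℝ} (hI : IntegrableOn u D (cableMeasure G hG))
    (huv : v =ᵐ[cableMeasure G hG] u) (F : Finset G.edgeSet) (κ : ℝ)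
    (hD : ∀ e ∈ F, ∀ t ∈ Icc (0 : ℝ) 1, cablePoint hG e t ∈ D)
    (hκ : ∀ e ∈ F, ∀ t ∈ Icc (0 : ℝ) 1, onCable v e t = κ) :
    F.card * |κ| ≤ ∫ x in D, |u x| ∂(cableMeasure G hG) := by
  have hpos : 0 ≤ ∫ x in D, |u x| ∂(cableMeasure G hG) := integral_nonneg fun _ => abs_nonneg _
  have h := sum_setLIntegral_le hDm (fun x => ‖v x‖ₑ) F Subset.rfl measurableSet_Icc hD
  rw [← ofReal_setIntegral_abs_eq hI huv] at h
  have h2 : ∑ e ∈ F, ∫⁻ t in Icc (0 : ℝ) 1, ‖v (cablePoint hG e t)‖ₑ =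
      ENNReal.ofReal (F.card * |κ|) := by
    rw [ENNReal.ofReal_mul (Nat.cast_nonneg _), ENNReal.ofReal_natCast, ← nsmul_eq_mul,
      ← Finset.sum_const]
    refine Finset.sum_congr rfl fun e he => ?_
    rw [setLIntegral_congr_fun (g := fun _ => ENNReal.ofReal |κ|) measurableSet_Icc fun t ht => ?_]
    · simp
    · have := hκ e he t ht
      rw [onCable_apply] at this
      simp only [this, ← ofReal_norm, Real.norm_eq_abs]
  rw [h2] at h
  exact (ENNReal.ofReal_le_ofReal_iff hpos).1 h

/-- The slope of an affine function on an interval is controlled by its `L¹` norm. -/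
theorem abs_slope_mul_le {f : ℝ → ℝ} {a b c s : ℝ} (hab : a ≤ b)
    (hf : ∀ t ∈ Icc a b, f t = c + s * (t - a)) :
    |s| * (b - a) ^ 2 ≤ 6 * ∫ t in a..b, |f t| := by
  rcases hab.eq_or_lt with rfl | hlt
  · simp
  set m := (a + b) / 2 with hm
  -- Testing with `t - m` sees the slope only, since this weight has mean zero.
  have h1 : ∫ t in a..b, f t * (t - m) = s * (b - a) ^ 3 / 12 := by
    have hd : ∀ t ∈ uIcc a b, HasDerivAt (fun t => (c + s * (m - a)) * ((t - m) ^ 2 / 2) +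
        s * ((t - m) ^ 3 / 3)) ((c + s * (t - a)) * (t - m)) t := by
      intro t _
      have e := (hasDerivAt_id t).sub_const m
      have := (((e.pow 2).div_const 2).const_mul (c + s * (m - a))).add
        (((e.pow 3).div_const 3).const_mul s)
      refine this.congr_deriv ?_
      simp only [id]
      push_cast
      ring
    have h2 := intervalIntegral.integral_eq_sub_of_hasDerivAt hd
      (Continuous.intervalIntegrable (by fun_prop) _ _)
    rw [intervalIntegral.integral_congr (g := fun t => (c + s * (t - a)) * (t - m))
      (fun t ht => ?_)]
    · rw [h2, hm]; ring
    · rw [uIcc_of_le hab] at ht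
      simp only [hf t ht]
  have hcont : ContinuousOn f (uIcc a b) := by
    rw [uIcc_of_le hab]
    exact ContinuousOn.congr (f := fun t => c + s * (t - a)) (by fun_prop) hf
  have hlin : Continuous fun t : ℝ => t - m := by fun_prop
  have h2 : |∫ t in a..b, f t * (t - m)| ≤ (b - a) / 2 * ∫ t in a..b, |f t| := by
    rw [← intervalIntegral.integral_const_mul]
    refine (intervalIntegral.abs_integral_le_integral_abs hab).trans ?_
    refine intervalIntegral.integral_mono_on hab
      ((hcont.mul hlin.continuousOn).abs.intervalIntegrable)
      (hcont.abs.intervalIntegrable.const_mul _) fun t ht => ?_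
    rw [abs_mul, mul_comm]
    refine mul_le_mul_of_nonneg_right ?_ (abs_nonneg _)
    rw [abs_le]
    constructor <;> rw [hm] <;> linarith [ht.1, ht.2]
  have hba : 0 < b - a := sub_pos.2 hlt
  rw [h1, abs_div, abs_mul, abs_of_pos (pow_pos hba 3), abs_of_pos (by norm_num : (0 : ℝ) < 12)]
    at h2
  have h3 : (b - a) * (|s| * (b - a) ^ 2) ≤ (b - a) * (6 * ∫ t in a..b, |f t|) := by nlinarith
  exact le_of_mul_le_mul_left h3 hba

/-- A function with constant gradient on a piece of a cable is affine there. -/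
theorem onCable_eq_affine {v g : CableSystem G hG → ℝ} {e : G.edgeSet}
    (hv : ∀ a ∈ Icc (0 : ℝ) 1, ∀ b ∈ Icc (0 : ℝ) 1,
      ∫ t in a..b, onCable g e t = onCable v e b - onCable v e a) {a b s : ℝ} (ha : 0 ≤ a)
    (hb : b ≤ 1) (hs : ∀ᵐ t, t ∈ Ioo a b → onCable g e t = s) :
    ∀ t ∈ Icc a b, onCable v e t = onCable v e a + s * (t - a) := by
  intro t ht
  have h := hv a ⟨ha, (ht.1.trans ht.2).trans hb⟩ t ⟨ha.trans ht.1, ht.2.trans hb⟩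
  rw [intervalIntegral.integral_of_le ht.1, ← restrict_Ioo_eq_restrict_Ioc,
    setIntegral_congr_ae (g := fun _ => s) measurableSet_Ioo] at h
  · rw [setIntegral_const, Real.volume_real_Ioo_of_le ht.1, smul_eq_mul] at h
    linarith
  · filter_upwards [hs] with x hx hxt using hx ⟨hxt.1, hxt.2.trans_le ht.2⟩

/-- The gradient of a harmonic function on a piece of a cable is controlled by the length of this
piece and the `L¹` norm of the function. -/
theorem IsHarmonicIn.ae_abs_grad_le_of_Icc [Countable G.edgeSet] {u : CableSystem G hG → ℝ}
    {D : Set (CableSystem G hG)} (hu : IsHarmonicIn u D) (hDm : MeasurableSet D)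
    (hI : IntegrableOn u D (cableMeasure G hG)) (e : G.edgeSet) {a b : ℝ} (ha : 0 ≤ a)
    (hab : a < b) (hb : b ≤ 1) (hD : ∀ t ∈ Icc a b, cablePoint hG e t ∈ D) :
    ∀ᵐ t, t ∈ Ioo a b → |onCable (energyGrad u) e t| * (b - a) ^ 2 ≤
      6 * ∫ x in D, |u x| ∂(cableMeasure G hG) := by
  obtain ⟨s, hs⟩ := hu.exists_grad_eq_const e ha hab hb hD
  obtain ⟨v, hvu, hv⟩ := (hasEnergyGrad_energyGrad hu.1).exists_primitive
  have haff := onCable_eq_affine (hv e) ha hb hs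
  have hcont : ContinuousOn (onCable v e) (Icc a b) :=
    ContinuousOn.congr (f := fun t => onCable v e a + s * (t - a)) (by fun_prop) haff
  have h1 := abs_slope_mul_le hab.le haff
  have h2 : ∫ t in a..b, |onCable v e t| ≤ ∫ x in D, |u x| ∂(cableMeasure G hG) := by
    have h := sum_setLIntegral_le hDm (fun x => ‖v x‖ₑ) {e} (Icc_subset_Icc ha hb)
      measurableSet_Icc (fun e' he' t ht => by rw [Finset.mem_singleton.1 he']; exact hD t ht)
    rw [← ofReal_setIntegral_abs_eq hI hvu, Finset.sum_singleton] at h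
    have hi : IntegrableOn (onCable v e) (Icc a b) := hcont.integrableOn_Icc
    have h3 := ofReal_integral_norm_eq_lintegral_enorm hi
    simp only [Real.norm_eq_abs, onCable_apply] at h3
    rw [← h3] at h
    rw [intervalIntegral.integral_of_le hab.le, ← integral_Icc_eq_integral_Ioc]
    exact (ENNReal.ofReal_le_ofReal_iff (integral_nonneg fun _ => abs_nonneg _)).1 h
  filter_upwards [hs] with t ht htm
  rw [ht htm]
  linarith

/-- The gradient estimate below the length of a cable. -/
theorem IsHarmonicIn.ae_abs_grad_le_of_ball [Countable G.edgeSet] {u : CableSystem G hG → ℝ}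
    {x₀ : CableSystem G hG} {r : ℝ} (hr : 0 < r) (hu : IsHarmonicIn u (Metric.ball x₀ (2 * r)))
    (hI : IntegrableOn u (Metric.ball x₀ (2 * r)) (cableMeasure G hG)) :
    ∀ᵐ x ∂(cableMeasure G hG), x ∈ Metric.ball x₀ r → |energyGrad u x| * min (r / 2) (1 / 2) ^ 2 ≤
      6 * ∫ x in Metric.ball x₀ (2 * r), |u x| ∂(cableMeasure G hG) := by
  set M := 6 * ∫ x in Metric.ball x₀ (2 * r), |u x| ∂(cableMeasure G hG) with hM
  refine ae_cableMeasure_iff.2 fun e => ?_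
  set S : Set ℝ := {t | t ∈ Ioo (0 : ℝ) 1 ∧ cablePoint hG e t ∈ Metric.ball x₀ r ∧
    ¬ |energyGrad u (cablePoint hG e t)| * min (r / 2) (1 / 2) ^ 2 ≤ M} with hS
  suffices hnull : volume S = 0 by
    have h1 : ∀ᵐ t, t ∉ S := measure_eq_zero_iff_ae_notMem.1 hnull
    filter_upwards [ae_restrict_of_ae h1, ae_mem_Ioo] with t ht ht01 hball
    by_contra hcon
    exact ht ⟨ht01, hball, hcon⟩
  refine measure_null_of_locally_null S fun t₀ ht₀ => ?_
  set a := max 0 (t₀ - r / 2) with ha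
  set b := min 1 (t₀ + r / 2) with hb
  have h0t := ht₀.1.1
  have ht1 := ht₀.1.2
  have hat : a < t₀ := max_lt h0t (by linarith)
  have htb : t₀ < b := lt_min ht1 (by linarith)
  have hlen : min (r / 2) (1 / 2) ≤ b - a := by
    rcases le_total t₀ (1 / 2) with h | h
    · have : min (r / 2) (1 / 2) + t₀ ≤ b := le_min
        (by linarith [min_le_right (r / 2) (1 / 2 : ℝ)]) (by linarith [min_le_left (r / 2) (1 / 2 : ℝ)])
      linarith
    · have : a ≤ t₀ - min (r / 2) (1 / 2) := max_le
        (by linarith [min_le_right (r / 2) (1 / 2 : ℝ)]) (by linarith [min_le_left (r / 2) (1 / 2 : ℝ)])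
      linarith
  have hpos : 0 < min (r / 2) (1 / 2 : ℝ) := lt_min (by linarith) (by norm_num)
  have hD : ∀ t ∈ Icc a b, cablePoint hG e t ∈ Metric.ball x₀ (2 * r) := by
    intro t ht
    have h1 : t ∈ Icc (0 : ℝ) 1 := ⟨(le_max_left _ _).trans ht.1, ht.2.trans (min_le_left _ _)⟩
    have h2 := dist_cablePoint (hG := hG) e h1 (Ioo_subset_Icc_self ht₀.1)
    have h3 : |t - t₀| ≤ r / 2 := abs_le.2 ⟨by linarith [(le_max_right 0 (t₀ - r / 2)).trans ht.1],
      by linarith [ht.2.trans (min_le_right 1 (t₀ + r / 2))]⟩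
    have h4 := dist_triangle (cablePoint hG e t) (cablePoint hG e t₀) x₀
    have h5 := Metric.mem_ball.1 ht₀.2.1
    rw [Metric.mem_ball]
    linarith
  have key := hu.ae_abs_grad_le_of_Icc Metric.isOpen_ball.measurableSet hI e (le_max_left _ _)
    (hat.trans htb) (min_le_left _ _) hD
  refine ⟨Ioo a b ∩ S, inter_mem (mem_nhdsWithin_of_mem_nhds (Ioo_mem_nhds hat htb))
    self_mem_nhdsWithin, ?_⟩
  refine measure_mono_null (fun t ht => ?_) (ae_iff.1 key)
  rw [mem_ofPred_eq, Classical.not_imp]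
  refine ⟨ht.1, fun hle => ht.2.2.2 (le_trans ?_ hle)⟩
  exact mul_le_mul_of_nonneg_left (pow_le_pow_left₀ hpos.le hlen 2) (abs_nonneg _)

/-- On a cable inside the domain of harmonicity, a harmonic function is affine, and its gradient is
the difference of the values at the end points. -/
theorem IsHarmonicIn.affine_on_cable [Countable G.edgeSet] {u v : CableSystem G hG → ℝ}
    {D : Set (CableSystem G hG)} (hu : IsHarmonicIn u D)
    (hv : ∀ e, ∀ a ∈ Icc (0 : ℝ) 1, ∀ b ∈ Icc (0 : ℝ) 1,
      ∫ t in a..b, onCable (energyGrad u) e t = onCable v e b - onCable v e a)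
    (e : G.edgeSet) (hD : ∀ t ∈ Icc (0 : ℝ) 1, cablePoint hG e t ∈ D) :
    (∀ t ∈ Icc (0 : ℝ) 1, onCable v e t = onCable v e 0 + (onCable v e 1 - onCable v e 0) * t) ∧
      ∀ᵐ t, t ∈ Ioo (0 : ℝ) 1 →
        onCable (energyGrad u) e t = onCable v e 1 - onCable v e 0 := by
  obtain ⟨s, hs⟩ := hu.exists_grad_eq_const e le_rfl zero_lt_one le_rfl hD
  have haff := onCable_eq_affine (hv e) le_rfl le_rfl hs
  have h1 : s = onCable v e 1 - onCable v e 0 := by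
    have := haff 1 ⟨zero_le_one, le_rfl⟩
    rw [sub_zero, mul_one] at this
    rw [this]
    ring
  rw [← h1]
  exact ⟨fun t ht => by rw [haff t ht, sub_zero], hs⟩

/-- The measure of a ball is at most the number of cables that it meets times its diameter, or the
length of a cable if this is smaller. -/
theorem cableMeasure_ball_le {x₀ : CableSystem G hG} {r : ℝ} (F : Finset G.edgeSet)
    (hF : ∀ e, ∀ t ∈ Icc (0 : ℝ) 1, cablePoint hG e t ∈ Metric.ball x₀ r → e ∈ F) :
    cableMeasure G hG (Metric.ball x₀ r) ≤ ENNReal.ofReal (F.card * min 1 (2 * r)) := by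
  have hm : MeasurableSet (Metric.ball x₀ r) := Metric.isOpen_ball.measurableSet
  rw [← lintegral_indicator_one hm, lintegral_cableMeasure, tsum_eq_sum (s := F)]
  · rw [ENNReal.ofReal_mul (Nat.cast_nonneg _), ENNReal.ofReal_natCast, ← nsmul_eq_mul,
      ← Finset.sum_const]
    refine Finset.sum_le_sum fun e _ => ?_
    have h1 : ∫⁻ t in Icc (0 : ℝ) 1, (Metric.ball x₀ r).indicator 1 (cablePoint hG e t) =
        volume (Icc (0 : ℝ) 1 ∩ cablePoint hG e ⁻¹' Metric.ball x₀ r) := by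
      have hm' := (continuous_cablePoint e).measurable hm
      rw [inter_comm, ← Measure.restrict_apply hm', ← lintegral_indicator_one hm']
      rfl
    rw [h1]
    refine (Real.volume_le_diam _).trans ?_
    refine Metric.ediam_le fun s hs t ht => ?_
    rw [edist_dist]
    refine ENNReal.ofReal_le_ofReal (le_min ?_ ?_)
    · rw [Real.dist_eq, abs_le]
      constructor <;> linarith [hs.1.1, hs.1.2, ht.1.1, ht.1.2]
    · rw [Real.dist_eq, ← dist_cablePoint (hG := hG) e hs.1 ht.1]
      have h2 := dist_triangle_right (cablePoint hG e s) (cablePoint hG e t) x₀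
      have h3 := Metric.mem_ball.1 hs.2
      have h4 := Metric.mem_ball.1 ht.2
      linarith
  · intro e he
    rw [setLIntegral_congr_fun (g := fun _ => 0) measurableSet_Icc, lintegral_zero]
    intro t ht
    exact indicator_of_notMem (fun h => he (hF e t ht h)) _

end CableSystem

namespace Vicsek

open CableSystem

variable {N : ℕ}

/-! ### Cells of the Vicsek graph in integer coordinates -/

/-- The corners `{0, 2}^N` of the cube, in the unit `1 / √N`. -/
def intCorners (N : ℕ) : Finset (Fin N → ℤ) := Fintype.piFinset fun _ => {0, 2}

/-- The corners and the center of the cube, in the unit `1 / √N`. -/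
def intNodes (N : ℕ) : Finset (Fin N → ℤ) := insert 1 (intCorners N)

/-- The set `3^n V_n`, in the unit `1 / √N`. -/
def intLevel (N : ℕ) : ℕ → Set (Fin N → ℤ)
  | 0 => {x | x ∈ intNodes N}
  | n + 1 => {x | ∃ p ∈ intNodes N, (fun k => x k - 2 * 3 ^ n * p k) ∈ intLevel N n}

/-- The vertices of the Vicsek graph, in the unit `1 / √N`. -/
def intVertices (N : ℕ) : Set (Fin N → ℤ) := {x | ∃ n, x ∈ intLevel N n}

/-- The cells of level `n` are the translates of `3^n V_n` by `2 * 3^n * b`. The cell `b` of level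
`n + 1` is the union of the cells `child b p` of level `n`, for the nodes `p`. -/
def child (b p : Fin N → ℤ) : Fin N → ℤ := fun k => 3 * b k + p k

/-- The offsets `b` of those cells which are part of the Vicsek graph: in the ternary expansion,
each digit of the vector `b` is a node. -/
inductive IsOffset : (Fin N → ℤ) → Prop
  | zero : IsOffset 0
  | step (b p : Fin N → ℤ) (hb : IsOffset b) (hp : p ∈ intNodes N) : IsOffset (child b p)

/-- The cell of level `n` with offset `b`. -/
def cell (n : ℕ) (b : Fin N → ℤ) : Set (Fin N → ℤ) :=
  {x | (fun k => x k - 2 * 3 ^ n * b k) ∈ intLevel N n}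

/-- The corner (or, for `p = 1`, the center) of the cell of level `n` with offset `b`. -/
def node (n : ℕ) (b p : Fin N → ℤ) : Fin N → ℤ := fun k => 3 ^ n * p k + 2 * 3 ^ n * b k

/-- The corner opposite to `p`. -/
def opp (p : Fin N → ℤ) : Fin N → ℤ := fun k => 2 - p k

/-- The offset of the cell on the other side of the corner `p` of the cell `b`. -/
def across (b p : Fin N → ℤ) : Fin N → ℤ := fun k => b k + p k - 1

/-- The point at diagonal position `r - 1` from `x`, for a corner `r`. -/
def diag (x r : Fin N → ℤ) : Fin N → ℤ := fun k => x k + r k - 1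

/-- Two integer points are joined if all their coordinates differ by `1`. -/
def IntJoined (x y : Fin N → ℤ) : Prop := ∀ k, y k - x k = 1 ∨ y k - x k = -1

theorem mem_intCorners {p : Fin N → ℤ} : p ∈ intCorners N ↔ ∀ k, p k = 0 ∨ p k = 2 := by
  simp [intCorners]

theorem mem_intNodes {p : Fin N → ℤ} : p ∈ intNodes N ↔ p = 1 ∨ p ∈ intCorners N := by
  simp [intNodes]

theorem corner_mem_intNodes {p : Fin N → ℤ} (hp : p ∈ intCorners N) : p ∈ intNodes N :=
  mem_intNodes.2 (Or.inr hp)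

theorem one_mem_intNodes : (1 : Fin N → ℤ) ∈ intNodes N := mem_intNodes.2 (Or.inl rfl)

theorem zero_mem_intCorners : (0 : Fin N → ℤ) ∈ intCorners N := mem_intCorners.2 fun _ => Or.inl rfl

theorem opp_mem_intCorners {p : Fin N → ℤ} (hp : p ∈ intCorners N) : opp p ∈ intCorners N := by
  rw [mem_intCorners] at hp ⊢
  intro k
  have := hp k
  unfold opp
  omega

theorem opp_opp (p : Fin N → ℤ) : opp (opp p) = p := by
  funext k
  unfold opp
  ring

theorem opp_ne [NeZero N] {p : Fin N → ℤ} (hp : p ∈ intCorners N) : opp p ≠ p := by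
  intro h
  have h1 := congrFun h 0
  have h2 := mem_intCorners.1 hp 0
  unfold opp at h1
  omega

theorem node_bounds {p : Fin N → ℤ} (hp : p ∈ intNodes N) (k : Fin N) : 0 ≤ p k ∧ p k ≤ 2 := by
  rcases mem_intNodes.1 hp with rfl | h
  · simp
  · have := mem_intCorners.1 h k
    omega

theorem IntJoined.symm {x y : Fin N → ℤ} (h : IntJoined x y) : IntJoined y x := fun k => by
  have := h k
  omega

/-- A cell lies in a cube. -/
theorem intLevel_bounds {n : ℕ} {x : Fin N → ℤ} (hx : x ∈ intLevel N n) (k : Fin N) :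
    0 ≤ x k ∧ x k ≤ 2 * 3 ^ n := by
  induction n generalizing x with
  | zero => simpa using node_bounds hx k
  | succ n ih =>
    obtain ⟨p, hp, hx⟩ := hx
    have h1 := ih hx
    have h2 := node_bounds hp k
    have h3 : (0 : ℤ) < 3 ^ n := by positivity
    rw [pow_succ]
    constructor <;> nlinarith

theorem cell_bounds {n : ℕ} {b x : Fin N → ℤ} (hx : x ∈ cell n b) (k : Fin N) :
    2 * 3 ^ n * b k ≤ x k ∧ x k ≤ 2 * 3 ^ n * b k + 2 * 3 ^ n := by
  have := intLevel_bounds hx k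
  constructor <;> linarith

theorem IsOffset.parity {b : Fin N → ℤ} (hb : IsOffset b) (k l : Fin N) : b k % 2 = b l % 2 := by
  induction hb with
  | zero => rfl
  | step b p _ hp ih =>
    unfold child
    rcases mem_intNodes.1 hp with rfl | h
    · simp only [Pi.one_apply]
      omega
    · have h1 := mem_intCorners.1 h k
      have h2 := mem_intCorners.1 h l
      omega

theorem IsOffset.exists_parent {b : Fin N → ℤ} (hb : IsOffset b) :
    ∃ c p, IsOffset c ∧ p ∈ intNodes N ∧ b = child c p := by
  cases hb with
  | zero =>
    exact ⟨0, 0, .zero, corner_mem_intNodes zero_mem_intCorners, by funext k; simp [child]⟩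
  | step b p hb hp => exact ⟨b, p, hb, hp, rfl⟩

theorem mem_cell_succ {n : ℕ} {b x : Fin N → ℤ} :
    x ∈ cell (n + 1) b ↔ ∃ p ∈ intNodes N, x ∈ cell n (child b p) := by
  have h : ∀ p : Fin N → ℤ, (fun k => x k - 2 * 3 ^ (n + 1) * b k - 2 * 3 ^ n * p k) =
      fun k => x k - 2 * 3 ^ n * child b p k := by
    intro p
    funext k
    unfold child
    ring
  constructor
  · rintro ⟨p, hp, hx⟩
    refine ⟨p, hp, ?_⟩
    simp only [h] at hx
    exact hx
  · rintro ⟨p, hp, hx⟩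
    refine ⟨p, hp, ?_⟩
    simp only [h]
    exact hx

theorem cell_child_subset {n : ℕ} {b p : Fin N → ℤ} (hp : p ∈ intNodes N) :
    cell n (child b p) ⊆ cell (n + 1) b := fun _ hx => mem_cell_succ.2 ⟨p, hp, hx⟩

theorem mem_cell_zero {b x : Fin N → ℤ} :
    x ∈ cell 0 b ↔ ∃ p ∈ intNodes N, x = node 0 b p := by
  constructor
  · intro hx
    exact ⟨_, hx, by funext k; simp [node]⟩
  · rintro ⟨p, hp, rfl⟩
    have : (fun k => node 0 b p k - 2 * 3 ^ 0 * b k) = p := by funext k; simp [node]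
    show _ ∈ intNodes N
    rwa [this]

theorem cell_subset_intVertices {n : ℕ} {b : Fin N → ℤ} (hb : IsOffset b) :
    cell n b ⊆ intVertices N := by
  induction hb generalizing n with
  | zero =>
    intro x hx
    refine ⟨n, ?_⟩
    simpa [cell] using hx
  | step b p _ hp ih => exact (cell_child_subset hp).trans ih

theorem exists_mem_cell_zero {x : Fin N → ℤ} (hx : x ∈ intVertices N) :
    ∃ b, IsOffset b ∧ x ∈ cell 0 b := by
  obtain ⟨n, hx⟩ := hx
  have key : ∀ n, ∀ b : Fin N → ℤ, IsOffset b → x ∈ cell n b → ∃ b, IsOffset b ∧ x ∈ cell 0 b := by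
    intro n
    induction n with
    | zero => exact fun b hb hx => ⟨b, hb, hx⟩
    | succ n ih =>
      intro b hb hx
      obtain ⟨p, hp, hx⟩ := mem_cell_succ.1 hx
      exact ih _ (.step b p hb hp) hx
  exact key n 0 .zero (by simpa [cell] using hx)

theorem exists_cell_zero_subset {b : Fin N → ℤ} (hb : IsOffset b) (n : ℕ) :
    ∃ c, IsOffset c ∧ cell 0 b ⊆ cell n c := by
  induction n with
  | zero => exact ⟨b, hb, Subset.rfl⟩
  | succ n ih =>
    obtain ⟨c, hc, hsub⟩ := ih
    obtain ⟨c', p, hc', hp, rfl⟩ := hc.exists_parent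
    exact ⟨c', hc', hsub.trans (cell_child_subset hp)⟩

/-- Every edge lies in a cell of level `0`, one of its end points being the center. -/
theorem exists_cell_zero_of_joined {x y : Fin N → ℤ} (hx : x ∈ intVertices N)
    (hy : y ∈ intVertices N) (h : IntJoined x y) : ∃ b, IsOffset b ∧
      ((x = node 0 b 1 ∧ ∃ p ∈ intCorners N, y = node 0 b p) ∨
        (y = node 0 b 1 ∧ ∃ p ∈ intCorners N, x = node 0 b p)) := by
  have aux : ∀ {x y b : Fin N → ℤ}, IntJoined x y → x = node 0 b 1 →
      ∃ p ∈ intCorners N, y = node 0 b p := by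
    intro x y b h hxb
    refine ⟨fun k => y k - 2 * b k, mem_intCorners.2 fun k => ?_, by funext k; simp [node]⟩
    have h1 := h k
    have h2 : x k = 1 + 2 * b k := by simp [hxb, node]
    omega
  obtain ⟨b, hb, hxb⟩ := exists_mem_cell_zero hx
  obtain ⟨p, hp, hxp⟩ := mem_cell_zero.1 hxb
  rcases mem_intNodes.1 hp with rfl | hpc
  · exact ⟨b, hb, Or.inl ⟨hxp, aux h hxp⟩⟩
  obtain ⟨c, hc, hyc⟩ := exists_mem_cell_zero hy
  obtain ⟨q, hq, hyq⟩ := mem_cell_zero.1 hyc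
  rcases mem_intNodes.1 hq with rfl | hqc
  · exact ⟨c, hc, Or.inr ⟨hyq, aux h.symm hyq⟩⟩
  -- Two corners cannot be joined, by parity; only the empty index type remains.
  rcases isEmpty_or_nonempty (Fin N) with hN | ⟨⟨k⟩⟩
  · exact ⟨b, hb, Or.inl ⟨Subsingleton.elim _ _, q, hqc, Subsingleton.elim _ _⟩⟩
  · exfalso
    have h1 := h k
    have h2 : x k = p k + 2 * b k := by simp [hxp, node]
    have h3 : y k = q k + 2 * c k := by simp [hyq, node]
    have h4 := mem_intCorners.1 hpc k
    have h5 := mem_intCorners.1 hqc k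
    omega

theorem exists_cell_of_joined {x y : Fin N → ℤ} (hx : x ∈ intVertices N)
    (hy : y ∈ intVertices N) (h : IntJoined x y) (n : ℕ) :
    ∃ b, IsOffset b ∧ x ∈ cell n b ∧ y ∈ cell n b := by
  obtain ⟨b, hb, hxy⟩ := exists_cell_zero_of_joined hx hy h
  obtain ⟨c, hc, hsub⟩ := exists_cell_zero_subset hb n
  refine ⟨c, hc, ?_⟩
  rcases hxy with ⟨h1, p, hp, h2⟩ | ⟨h1, p, hp, h2⟩
  · exact ⟨hsub (mem_cell_zero.2 ⟨1, one_mem_intNodes, h1⟩),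
      hsub (mem_cell_zero.2 ⟨p, corner_mem_intNodes hp, h2⟩)⟩
  · exact ⟨hsub (mem_cell_zero.2 ⟨p, corner_mem_intNodes hp, h2⟩),
      hsub (mem_cell_zero.2 ⟨1, one_mem_intNodes, h1⟩)⟩

/-- Two cells of the same level meet in a common corner at most: their cubes can only meet if the
offsets differ by at most `1` in each coordinate, and by parity all coordinates of the offsets then
differ by exactly `1`. -/
theorem cell_inter {n : ℕ} {b c x : Fin N → ℤ} (hb : IsOffset b) (hc : IsOffset c) (hbc : c ≠ b)
    (hxb : x ∈ cell n b) (hxc : x ∈ cell n c) :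
    ∃ p ∈ intCorners N, x = node n b p ∧ c = across b p := by
  have h3 : (0 : ℤ) < 3 ^ n := by positivity
  have hle : ∀ k, c k - b k ≤ 1 ∧ -1 ≤ c k - b k := by
    intro k
    have h1 := cell_bounds hxb k
    have h2 := cell_bounds hxc k
    constructor <;> by_contra hcon <;> nlinarith
  obtain ⟨l, hl⟩ := Function.ne_iff.1 hbc
  have hpm : ∀ k, c k - b k = 1 ∨ c k - b k = -1 := by
    intro k
    have h1 := hle k
    have h2 := hle l
    have h4 := hb.parity k l
    have h5 := hc.parity k l
    omega
  refine ⟨fun k => c k - b k + 1, mem_intCorners.2 fun k => ?_, ?_, ?_⟩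
  · have := hpm k
    omega
  · funext k
    have h1 := cell_bounds hxb k
    have h2 := cell_bounds hxc k
    unfold node
    rcases hpm k with h | h
    · have hck : c k = b k + 1 := by omega
      simp only [hck] at h2 ⊢
      linarith
    · have hck : c k = b k - 1 := by omega
      simp only [hck] at h2 ⊢
      linarith
  · funext k
    unfold across
    ring

theorem node_succ (n : ℕ) (b p : Fin N → ℤ) : node (n + 1) b p = node n (child b p) p := by
  funext k
  unfold node child
  ring

theorem node_mem_cell {n : ℕ} {b p : Fin N → ℤ} (hp : p ∈ intNodes N) : node n b p ∈ cell n b := by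
  induction n generalizing b with
  | zero => exact mem_cell_zero.2 ⟨p, hp, rfl⟩
  | succ n ih =>
    refine mem_cell_succ.2 ⟨p, hp, ?_⟩
    rw [node_succ]
    exact ih

theorem node_injective {n : ℕ} {b p q : Fin N → ℤ} (h : node n b p = node n b q) : p = q := by
  funext k
  have h1 := congrFun h k
  have h3 : (0 : ℤ) < 3 ^ n := by positivity
  unfold node at h1
  exact mul_left_cancel₀ h3.ne' (by linarith)

theorem node_across (n : ℕ) (b p : Fin N → ℤ) : node n (across b p) (opp p) = node n b p := by
  funext k
  unfold node across opp
  ring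

/-- The neighbor of the corner `p` in the cell `b`. -/
theorem diag_opp_mem_cell {n : ℕ} {b p : Fin N → ℤ} (hp : p ∈ intCorners N) :
    diag (node n b p) (opp p) ∈ cell n b := by
  induction n generalizing b with
  | zero =>
    refine mem_cell_zero.2 ⟨1, one_mem_intNodes, ?_⟩
    funext k
    simp only [diag, node, opp, Pi.one_apply]
    ring
  | succ n ih =>
    rw [node_succ]
    exact cell_child_subset (corner_mem_intNodes hp) ih

theorem intJoined_diag (x : Fin N → ℤ) {r : Fin N → ℤ} (hr : r ∈ intCorners N) :
    IntJoined x (diag x r) := fun k => by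
  have := mem_intCorners.1 hr k
  unfold diag
  omega

theorem diag_injective {x p q : Fin N → ℤ} (h : diag x p = diag x q) : p = q := by
  funext k
  have := congrFun h k
  unfold diag at this
  omega

theorem IntJoined.exists_diag {x y : Fin N → ℤ} (h : IntJoined x y) :
    ∃ r ∈ intCorners N, y = diag x r := by
  refine ⟨fun k => y k - x k + 1, mem_intCorners.2 fun k => ?_, ?_⟩
  · have := h k
    omega
  · funext k
    unfold diag
    ring

/-- A corner has only one neighbor within its cell. -/
theorem eq_diag_of_mem_cell {n : ℕ} {b p r : Fin N → ℤ} (hp : p ∈ intCorners N)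
    (hr : r ∈ intCorners N) (h : diag (node n b p) r ∈ cell n b) : r = opp p := by
  funext k
  have h1 := cell_bounds h k
  have h2 := mem_intCorners.1 hp k
  have h3 := mem_intCorners.1 hr k
  unfold diag node at h1
  unfold opp
  rcases h2 with h2 | h2 <;> rcases h3 with h3 | h3 <;> rw [h2, h3] at h1 ⊢ <;> omega

/-- A vertex of a cell other than a corner has all its neighbors in the cell. -/
theorem mem_cell_of_joined {n : ℕ} {b x y : Fin N → ℤ} (hb : IsOffset b) (hx : x ∈ cell n b)
    (hxc : ∀ p ∈ intCorners N, x ≠ node n b p) (hy : y ∈ intVertices N) (h : IntJoined x y) :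
    y ∈ cell n b := by
  obtain ⟨c, hc, hxc', hyc⟩ := exists_cell_of_joined (cell_subset_intVertices hb hx) hy h n
  by_cases hcb : c = b
  · rwa [hcb] at hyc
  · obtain ⟨p, hp, hxp, -⟩ := cell_inter hb hc hcb hx hxc'
    exact absurd hxp (hxc p hp)

/-- The neighbors of a corner of a cell: one in this cell, and possibly one in the cell across the
corner. -/
theorem eq_or_of_diag_node_mem {n : ℕ} {b p r : Fin N → ℤ} (hb : IsOffset b)
    (hp : p ∈ intCorners N) (hr : r ∈ intCorners N) (h : diag (node n b p) r ∈ intVertices N) :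
    r = opp p ∨ (IsOffset (across b p) ∧ r = p) := by
  have hn := node_mem_cell (n := n) (b := b) (corner_mem_intNodes hp)
  obtain ⟨c, hc, hxc, hyc⟩ := exists_cell_of_joined (cell_subset_intVertices hb hn) h
    (intJoined_diag _ hr) n
  by_cases hcb : c = b
  · rw [hcb] at hyc
    exact Or.inl (eq_diag_of_mem_cell hp hr hyc)
  · obtain ⟨q, hq, hpq, rfl⟩ := cell_inter hb hc hcb hn hxc
    obtain rfl := node_injective hpq
    rw [← node_across] at hyc
    refine Or.inr ⟨hc, ?_⟩
    rw [eq_diag_of_mem_cell (opp_mem_intCorners hp) hr hyc, opp_opp]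

/-- A corner of a corner cell, other than the two on the diagonal, is a dead end. -/
theorem not_isOffset_across_child {b p q : Fin N → ℤ} (hp : p ∈ intCorners N)
    (hq : q ∈ intCorners N) (hqp : q ≠ p) (hqo : q ≠ opp p) :
    ¬ IsOffset (across (child b p) q) := by
  intro h
  obtain ⟨c, s, -, hs, he⟩ := h.exists_parent
  obtain ⟨k, hk⟩ := Function.ne_iff.1 hqp
  obtain ⟨l, hl⟩ := Function.ne_iff.1 hqo
  have ek := congrFun he k
  have el := congrFun he l
  have h1 := mem_intCorners.1 hp k
  have h2 := mem_intCorners.1 hp l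
  have h3 := mem_intCorners.1 hq k
  have h4 := mem_intCorners.1 hq l
  unfold across child at ek el
  unfold opp at hl
  rcases mem_intNodes.1 hs with rfl | hs
  · simp only [Pi.one_apply] at ek el
    omega
  · have h5 := mem_intCorners.1 hs k
    have h6 := mem_intCorners.1 hs l
    omega

/-- Joined vertices of a cell lie in a common subcell. -/
theorem exists_child_of_joined [NeZero N] {n : ℕ} {b x y : Fin N → ℤ} (hb : IsOffset b)
    (hx : x ∈ cell (n + 1) b) (hy : y ∈ cell (n + 1) b) (h : IntJoined x y) :
    ∃ p ∈ intNodes N, x ∈ cell n (child b p) ∧ y ∈ cell n (child b p) := by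
  obtain ⟨c, hc, hxc, hyc⟩ := exists_cell_of_joined (cell_subset_intVertices hb hx)
    (cell_subset_intVertices hb hy) h n
  obtain ⟨d, p, hd, hp, rfl⟩ := hc.exists_parent
  by_cases hdb : d = b
  · rw [hdb] at hxc hyc
    exact ⟨p, hp, hxc, hyc⟩
  · exfalso
    obtain ⟨q, hq, hxq, -⟩ := cell_inter hb hd hdb hx (cell_child_subset hp hxc)
    obtain ⟨r, hr, hyr, -⟩ := cell_inter hb hd hdb hy (cell_child_subset hp hyc)
    have h1 := h 0
    have h2 := mem_intCorners.1 hq 0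
    have h3 := mem_intCorners.1 hr 0
    rw [hxq, hyr] at h1
    unfold node at h1
    rcases h2 with h2 | h2 <;> rcases h3 with h3 | h3 <;> rw [h2, h3] at h1 <;> omega

/-! ### Descendants of a cell -/

/-- The relative offsets of the cells of level `0` in a cell of level `n`. -/
def descendants (N : ℕ) : ℕ → Finset (Fin N → ℤ)
  | 0 => {0}
  | n + 1 => (descendants N n ×ˢ intNodes N).image fun wp => child wp.1 wp.2

/-- The offset of a cell of level `m` in the cell `b` of level `m + n`. -/
def descend (n : ℕ) (b w : Fin N → ℤ) : Fin N → ℤ := fun k => 3 ^ n * b k + w k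

theorem descend_zero (b : Fin N → ℤ) : descend 0 b 0 = b := by
  funext k
  simp [descend]

theorem descend_child (n : ℕ) (b w p : Fin N → ℤ) :
    descend (n + 1) b (child w p) = child (descend n b w) p := by
  funext k
  unfold descend child
  ring

theorem child_injective {w w' p p' : Fin N → ℤ} (hp : p ∈ intNodes N) (hp' : p' ∈ intNodes N)
    (h : child w p = child w' p') : w = w' ∧ p = p' := by
  have key : ∀ k, w k = w' k ∧ p k = p' k := by
    intro k
    have h1 := congrFun h k
    have h2 := node_bounds hp k
    have h3 := node_bounds hp' k
    unfold child at h1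
    omega
  exact ⟨funext fun k => (key k).1, funext fun k => (key k).2⟩

theorem card_intCorners : (intCorners N).card = 2 ^ N := by
  simp [intCorners]

theorem card_intNodes [NeZero N] : (intNodes N).card = 2 ^ N + 1 := by
  rw [intNodes, Finset.card_insert_of_notMem, card_intCorners]
  intro h
  have := mem_intCorners.1 h 0
  simp at this

theorem card_descendants [NeZero N] (n : ℕ) : (descendants N n).card = (2 ^ N + 1) ^ n := by
  induction n with
  | zero => simp [descendants]
  | succ n ih =>
    rw [descendants, Finset.card_image_of_injOn, Finset.card_product, ih, card_intNodes, pow_succ]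
    rintro ⟨w, p⟩ h1 ⟨w', p'⟩ h2 h
    have h1 := (Finset.mem_product.1 h1).2
    have h2 := (Finset.mem_product.1 h2).2
    obtain ⟨h3, h4⟩ := child_injective h1 h2 h
    exact Prod.ext h3 h4

theorem isOffset_descend {n : ℕ} {b w : Fin N → ℤ} (hb : IsOffset b) (hw : w ∈ descendants N n) :
    IsOffset (descend n b w) := by
  induction n generalizing w with
  | zero =>
    obtain rfl := Finset.mem_singleton.1 hw
    rwa [descend_zero]
  | succ n ih =>
    obtain ⟨⟨w, p⟩, h1, rfl⟩ := Finset.mem_image.1 hw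
    rw [Finset.mem_product] at h1
    rw [descend_child]
    exact .step _ _ (ih h1.1) h1.2

theorem cell_descend_subset {n : ℕ} (m : ℕ) {b w : Fin N → ℤ} (hw : w ∈ descendants N n) :
    cell m (descend n b w) ⊆ cell (m + n) b := by
  induction n generalizing w m with
  | zero =>
    obtain rfl := Finset.mem_singleton.1 hw
    rw [descend_zero]
    rfl
  | succ n ih =>
    obtain ⟨⟨w, p⟩, h1, rfl⟩ := Finset.mem_image.1 hw
    rw [Finset.mem_product] at h1
    rw [descend_child]
    refine (cell_child_subset h1.2).trans ((ih (m + 1) h1.1).trans ?_)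
    rw [add_right_comm, add_assoc]

theorem IsOffset.exists_descend {c : Fin N → ℤ} (hc : IsOffset c) (n : ℕ) :
    ∃ b w, IsOffset b ∧ w ∈ descendants N n ∧ c = descend n b w := by
  induction n generalizing c with
  | zero => exact ⟨c, 0, hc, Finset.mem_singleton_self _, (descend_zero c).symm⟩
  | succ n ih =>
    obtain ⟨d, p, hd, hp, rfl⟩ := hc.exists_parent
    obtain ⟨b, w, hb, hw, rfl⟩ := ih hd
    exact ⟨b, child w p, hb, Finset.mem_image.2 ⟨(w, p), Finset.mem_product.2 ⟨hw, hp⟩, rfl⟩,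
      (descend_child n b w p).symm⟩

theorem descendants_bounds {n : ℕ} {w : Fin N → ℤ} (hw : w ∈ descendants N n) (k : Fin N) :
    0 ≤ w k ∧ w k ≤ 3 ^ n - 1 := by
  induction n generalizing w with
  | zero =>
    obtain rfl := Finset.mem_singleton.1 hw
    simp
  | succ n ih =>
    obtain ⟨⟨w, p⟩, h1, rfl⟩ := Finset.mem_image.1 hw
    rw [Finset.mem_product] at h1
    have h2 := ih h1.1
    have h3 := node_bounds h1.2 k
    simp only [child, pow_succ] at h2 h3 ⊢
    omega

/-! ### Discrete harmonic functions on cells -/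

/-- The Laplace operator of the Vicsek graph, in integer coordinates. -/
def intLaplacian (H : (Fin N → ℤ) → ℝ) (x : Fin N → ℤ) : ℝ :=
  open scoped Classical in
  ∑ r ∈ intCorners N, if diag x r ∈ intVertices N then H (diag x r) - H x else 0

/-- `H` is harmonic in the cell `b` of level `n`, except possibly at its corners. -/
def HarmonicInCell (H : (Fin N → ℤ) → ℝ) (n : ℕ) (b : Fin N → ℤ) : Prop :=
  ∀ x ∈ cell n b, (∀ p ∈ intCorners N, x ≠ node n b p) → intLaplacian H x = 0

/-- The flux of `H` out of a cell through its corner `p`. -/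
def flux (H : (Fin N → ℤ) → ℝ) (n : ℕ) (b p : Fin N → ℤ) : ℝ :=
  H (node n b p) - H (diag (node n b p) (opp p))

variable {H : (Fin N → ℤ) → ℝ} {n : ℕ} {b p q : Fin N → ℤ}

theorem flux_succ (H : (Fin N → ℤ) → ℝ) (n : ℕ) (b p : Fin N → ℤ) :
    flux H (n + 1) b p = flux H n (child b p) p := by
  rw [flux, flux, node_succ]

/-- There is no flux out of a cell through a dead end. -/
theorem flux_eq_zero_of_dead (hb : IsOffset b) (hp : p ∈ intCorners N)
    (hdead : ¬ IsOffset (across b p)) (h : intLaplacian H (node n b p) = 0) :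
    flux H n b p = 0 := by
  classical
  rw [intLaplacian, Finset.sum_eq_single (opp p)] at h
  · rw [if_pos (cell_subset_intVertices hb (diag_opp_mem_cell hp))] at h
    rw [flux]
    linarith
  · intro r hr hne
    refine if_neg fun hmem => ?_
    rcases eq_or_of_diag_node_mem hb hp hr hmem with h1 | h1
    exacts [hne h1, hdead h1.1]
  · exact fun hcon => absurd (opp_mem_intCorners hp) hcon

/-- The fluxes of two adjacent cells through their common corner cancel. -/
theorem flux_add_flux_across [NeZero N] (hb : IsOffset b) (hp : p ∈ intCorners N)
    (hac : IsOffset (across b p)) (h : intLaplacian H (node n b p) = 0) :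
    flux H n b p + flux H n (across b p) (opp p) = 0 := by
  classical
  have hm2 : diag (node n b p) p ∈ intVertices N := by
    have := diag_opp_mem_cell (n := n) (b := across b p) (opp_mem_intCorners hp)
    rw [node_across, opp_opp] at this
    exact cell_subset_intVertices hac this
  rw [intLaplacian, Finset.sum_eq_add (opp p) p (opp_ne hp)] at h
  · rw [if_pos (cell_subset_intVertices hb (diag_opp_mem_cell hp)), if_pos hm2] at h
    rw [flux, flux, node_across, opp_opp]
    linarith
  · intro r hr hne
    refine if_neg fun hmem => ?_
    rcases eq_or_of_diag_node_mem hb hp hr hmem with h1 | h1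
    exacts [hne.1 h1, hne.2 h1.2]
  · exact fun hcon => absurd (opp_mem_intCorners hp) hcon
  · exact fun hcon => absurd hp hcon

theorem across_center_child (b p : Fin N → ℤ) : across (child b 1) p = child b p := by
  funext k
  simp only [across, child, Pi.one_apply]
  ring

theorem HarmonicInCell.restrict (h : HarmonicInCell H (n + 1) b) (hb : IsOffset b)
    (hq : q ∈ intNodes N) : HarmonicInCell H n (child b q) := by
  intro x hx hxc
  refine h x (cell_child_subset hq hx) fun p hp hxp => ?_
  rw [node_succ] at hxp
  by_cases hpq : child b p = child b q
  · rw [hpq] at hxp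
    exact hxc p hp hxp
  · obtain ⟨r, hr, hxr, -⟩ := cell_inter (.step b q hb hq)
      (.step b p hb (corner_mem_intNodes hp)) hpq hx
      (hxp ▸ node_mem_cell (corner_mem_intNodes hp))
    exact hxc r hr hxr

/-- The flux from the central subcell into a corner subcell. -/
theorem HarmonicInCell.flux_center_add [NeZero N] (h : HarmonicInCell H (n + 1) b)
    (hb : IsOffset b) (hp : p ∈ intCorners N) :
    flux H n (child b 1) p + flux H n (child b p) (opp p) = 0 := by
  have hc := IsOffset.step b 1 hb one_mem_intNodes
  have hcp := IsOffset.step b p hb (corner_mem_intNodes hp)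
  rw [← across_center_child b p] at hcp ⊢
  refine flux_add_flux_across hc hp hcp (h _ (cell_child_subset one_mem_intNodes
    (node_mem_cell (corner_mem_intNodes hp))) fun r hr heq => ?_)
  have h1 := congrFun heq 0
  have h2 := mem_intCorners.1 hp 0
  have h3 := mem_intCorners.1 hr 0
  have h4 : (0 : ℤ) < 3 ^ n := by positivity
  simp only [node, child, Pi.one_apply, pow_succ] at h1
  rcases h2 with h2 | h2 <;> rcases h3 with h3 | h3 <;> rw [h2, h3] at h1 <;> linarith

/-- The dead ends of a corner subcell. -/
theorem HarmonicInCell.flux_child_eq_zero (h : HarmonicInCell H (n + 1) b) (hb : IsOffset b)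
    (hp : p ∈ intCorners N) (hq : q ∈ intCorners N) (hqp : q ≠ p) (hqo : q ≠ opp p) :
    flux H n (child b p) q = 0 := by
  have hcp := IsOffset.step b p hb (corner_mem_intNodes hp)
  refine flux_eq_zero_of_dead hcp hq (not_isOffset_across_child hp hq hqp hqo)
    (h _ (cell_child_subset (corner_mem_intNodes hp) (node_mem_cell (corner_mem_intNodes hq)))
      fun r hr heq => hqp ?_)
  funext k
  have h1 := congrFun heq k
  have h2 := mem_intCorners.1 hp k
  have h3 := mem_intCorners.1 hr k
  have h5 := mem_intCorners.1 hq k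
  have h4 : (0 : ℤ) < 3 ^ n := by positivity
  simp only [node, child, pow_succ] at h1
  rcases h2 with h2 | h2 <;> rcases h3 with h3 | h3 <;> rcases h5 with h5 | h5 <;>
    rw [h2, h3, h5] at h1 <;> rw [h2, h5] <;> exfalso <;> linarith

/-- The fluxes out of a cell sum up to zero, and on the segment from the center to a corner the
function is affine, with the flux as slope. -/
theorem HarmonicInCell.sum_flux_and_affine [NeZero N] (h : HarmonicInCell H n b)
    (hb : IsOffset b) : ∑ p ∈ intCorners N, flux H n b p = 0 ∧
      ∀ p ∈ intCorners N, H (node n b p) - H (node n b 1) = 3 ^ n * flux H n b p := by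
  classical
  induction n generalizing b with
  | zero =>
    have hd : ∀ p : Fin N → ℤ, diag (node 0 b p) (opp p) = node 0 b 1 := by
      intro p
      funext k
      simp only [diag, node, opp, Pi.one_apply]
      ring
    have hd' : ∀ p : Fin N → ℤ, diag (node 0 b 1) p = node 0 b p := by
      intro p
      funext k
      simp only [diag, node, Pi.one_apply]
      ring
    refine ⟨?_, fun p _ => by rw [flux, hd, pow_zero, one_mul]⟩
    have h1 := h (node 0 b 1) (node_mem_cell one_mem_intNodes) fun p hp heq => by
      have h2 := congrFun (node_injective heq) 0
      have h3 := mem_intCorners.1 hp 0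
      rw [Pi.one_apply] at h2
      omega
    rw [intLaplacian] at h1
    rw [← h1]
    refine Finset.sum_congr rfl fun p hp => ?_
    rw [hd', if_pos (cell_subset_intVertices hb (node_mem_cell (corner_mem_intNodes hp))), flux, hd]
  | succ n ih =>
    have hc := ih (h.restrict hb one_mem_intNodes) (.step b 1 hb one_mem_intNodes)
    have hcorner : ∀ p ∈ intCorners N, flux H n (child b p) p +
        flux H n (child b p) (opp p) = 0 := by
      intro p hp
      have hs := (ih (h.restrict hb (corner_mem_intNodes hp))
        (.step b p hb (corner_mem_intNodes hp))).1
      rwa [Finset.sum_eq_add p (opp p) (opp_ne hp).symm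
        (fun q hq hne => h.flux_child_eq_zero hb hp hq hne.1 hne.2)
        (fun hcon => absurd hp hcon) (fun hcon => absurd (opp_mem_intCorners hp) hcon)] at hs
    have heq : ∀ p ∈ intCorners N, flux H (n + 1) b p = flux H n (child b 1) p := by
      intro p hp
      rw [flux_succ]
      linarith [hcorner p hp, h.flux_center_add hb hp]
    refine ⟨by rw [Finset.sum_congr rfl heq]; exact hc.1, fun p hp => ?_⟩
    have hcp := (ih (h.restrict hb (corner_mem_intNodes hp))
      (.step b p hb (corner_mem_intNodes hp))).2
    have h1 := hcp p hp
    have h2 := hcp (opp p) (opp_mem_intCorners hp)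
    have h3 := hc.2 p hp
    have h4 := heq p hp
    have h5 := h.flux_center_add hb hp
    have h6 := node_across n (child b 1) p
    rw [across_center_child] at h6
    rw [h6] at h2
    rw [← flux_succ, ← node_succ] at h1
    have h7 : flux H n (child b p) (opp p) = -flux H (n + 1) b p := by linarith
    rw [h7] at h2
    rw [← h4] at h3
    rw [node_succ n b 1, pow_succ]
    linarith

theorem HarmonicInCell.flux_child_opp [NeZero N] (h : HarmonicInCell H (n + 1) b)
    (hb : IsOffset b) (hp : p ∈ intCorners N) :
    flux H n (child b p) (opp p) = -flux H (n + 1) b p := by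
  classical
  have hs := ((h.restrict hb (corner_mem_intNodes hp)).sum_flux_and_affine
    (.step b p hb (corner_mem_intNodes hp))).1
  rw [Finset.sum_eq_add p (opp p) (opp_ne hp).symm
    (fun q hq hne => h.flux_child_eq_zero hb hp hq hne.1 hne.2)
    (fun hcon => absurd hp hcon) (fun hcon => absurd (opp_mem_intCorners hp) hcon)] at hs
  rw [flux_succ]
  linarith

/-- All increments of `H` along the edges of a cell are bounded by the fluxes. -/
theorem HarmonicInCell.abs_sub_le [NeZero N] (h : HarmonicInCell H n b) (hb : IsOffset b) {M : ℝ}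
    (hM : ∀ p ∈ intCorners N, |flux H n b p| ≤ M) {x y : Fin N → ℤ} (hx : x ∈ cell n b)
    (hy : y ∈ cell n b) (hxy : IntJoined x y) : |H x - H y| ≤ M := by
  have hM0 : 0 ≤ M := (abs_nonneg _).trans (hM 0 zero_mem_intCorners)
  induction n generalizing b with
  | zero =>
    have haff := (h.sum_flux_and_affine hb).2
    obtain ⟨p, hp, rfl⟩ := mem_cell_zero.1 hx
    obtain ⟨q, hq, rfl⟩ := mem_cell_zero.1 hy
    have h0 := hxy 0
    simp only [node] at h0
    rcases mem_intNodes.1 hp with rfl | hp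
    · rcases mem_intNodes.1 hq with rfl | hq
      · omega
      · rw [abs_sub_comm, haff q hq, pow_zero, one_mul]
        exact hM q hq
    · rcases mem_intNodes.1 hq with rfl | hq
      · rw [haff p hp, pow_zero, one_mul]
        exact hM p hp
      · have h1 := mem_intCorners.1 hp 0
        have h2 := mem_intCorners.1 hq 0
        omega
  | succ n ih =>
    obtain ⟨q, hq, hxq, hyq⟩ := exists_child_of_joined hb hx hy hxy
    refine ih (h.restrict hb hq) (.step b q hb hq) (fun p hp => ?_) hxq hyq
    rcases mem_intNodes.1 hq with rfl | hqc
    · have h1 := h.flux_center_add hb hp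
      rw [h.flux_child_opp hb hp] at h1
      have h2 : flux H n (child b 1) p = flux H (n + 1) b p := by linarith
      rw [h2]
      exact hM p hp
    · by_cases hpq : p = q
      · rw [hpq, ← flux_succ]
        exact hM q hqc
      by_cases hpo : p = opp q
      · rw [hpo, h.flux_child_opp hb hqc, abs_neg]
        exact hM q hqc
      · rw [h.flux_child_eq_zero hb hqc hp hpq hpo, abs_zero]
        exact hM0

/-- Every vertex of a cell of level `n` has distance at most `3^n` from its center, for any
pseudodistance for which the edges of the cell have length at most `1`. -/
theorem dist_center_le (d : (Fin N → ℤ) → (Fin N → ℤ) → ℝ) (hself : ∀ x, d x x = 0)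
    (hsymm : ∀ x y, d x y = d y x) (htri : ∀ x y z, d x z ≤ d x y + d y z) {M : ℝ} (hM : 0 ≤ M)
    (hd : ∀ x ∈ cell n b, ∀ y ∈ cell n b, IntJoined x y → d x y ≤ M) :
    ∀ x ∈ cell n b, d x (node n b 1) ≤ 3 ^ n * M := by
  induction n generalizing b with
  | zero =>
    intro x hx
    have h1 := mem_cell_zero.1 hx
    obtain ⟨p, hp, rfl⟩ := h1
    rw [pow_zero, one_mul]
    rcases mem_intNodes.1 hp with rfl | hpc
    · rwa [hself]
    · refine hd _ hx _ (node_mem_cell one_mem_intNodes) fun k => ?_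
      have := mem_intCorners.1 hpc k
      simp only [node, Pi.one_apply]
      omega
  | succ n ih =>
    have hd' : ∀ q ∈ intNodes N, ∀ x ∈ cell n (child b q), d x (node n (child b q) 1) ≤ 3 ^ n * M :=
      fun q hq => ih fun x hx y hy => hd x (cell_child_subset hq hx) y (cell_child_subset hq hy)
    intro x hx
    have h3 : (0 : ℝ) < 3 ^ n := by positivity
    obtain ⟨q, hq, hxq⟩ := mem_cell_succ.1 hx
    have h1 := hd' q hq x hxq
    rw [node_succ, pow_succ]
    rcases mem_intNodes.1 hq with rfl | hqc
    · nlinarith [mul_nonneg h3.le hM]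
    · -- Pass through the joint of the corner subcell and the central subcell.
      have h2 := hd' 1 one_mem_intNodes _ (node_mem_cell (corner_mem_intNodes hqc))
      have h4 := hd' q hq _ (node_mem_cell (corner_mem_intNodes (opp_mem_intCorners hqc)))
      have h5 := node_across n (child b 1) q
      rw [across_center_child] at h5
      rw [h5, hsymm] at h4
      have h6 := htri x (node n (child b q) 1) (node n (child b 1) 1)
      have h7 := htri (node n (child b q) 1) (node n (child b 1) q) (node n (child b 1) 1)
      linarith

/-- If no flux leaves a cell through its corner `q`, then the function is constant on the subcell
at this corner, with the value at the center of the cell. -/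
theorem HarmonicInCell.eq_center_of_flux_eq_zero [NeZero N] (h : HarmonicInCell H (n + 1) b)
    (hb : IsOffset b) (hq : q ∈ intCorners N) (h0 : flux H (n + 1) b q = 0) :
    ∀ x ∈ cell n (child b q), H x = H (node (n + 1) b 1) := by
  have hc := h.restrict hb (corner_mem_intNodes hq)
  have hcb := IsOffset.step b q hb (corner_mem_intNodes hq)
  have hflux : ∀ p ∈ intCorners N, |flux H n (child b q) p| ≤ 0 := by
    intro p hp
    by_cases hpq : p = q
    · rw [hpq, ← flux_succ, h0, abs_zero]
    by_cases hpo : p = opp q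
    · rw [hpo, h.flux_child_opp hb hq, h0, neg_zero, abs_zero]
    · rw [h.flux_child_eq_zero hb hq hp hpq hpo, abs_zero]
  have key := dist_center_le (n := n) (b := child b q) (fun x y => |H x - H y|)
    (fun x => by simp) (fun x y => abs_sub_comm _ _) (fun x y z => _root_.abs_sub_le _ _ _) le_rfl
    (fun x hx y hy hxy => hc.abs_sub_le hcb hflux hx hy hxy)
  have hconst : ∀ x ∈ cell n (child b q), H x = H (node n (child b q) 1) := by
    intro x hx
    have := key x hx
    rw [mul_zero] at this
    exact sub_eq_zero.1 (abs_eq_zero.1 (le_antisymm this (abs_nonneg _)))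
  have h1 := (h.sum_flux_and_affine hb).2 q hq
  rw [h0, mul_zero, node_succ n b q, hconst _ (node_mem_cell (corner_mem_intNodes hq))] at h1
  intro x hx
  rw [hconst x hx]
  linarith

/-- A corner different from `p` and from the opposite of `p`. It exists in dimension at least
two. -/
theorem exists_third_corner (hN : 2 ≤ N) (hp : p ∈ intCorners N) :
    ∃ q ∈ intCorners N, q ≠ p ∧ q ≠ opp p := by
  have hp' := mem_intCorners.1 hp
  set i : Fin N := ⟨0, by omega⟩
  set j : Fin N := ⟨1, by omega⟩
  have hij : i ≠ j := by simp [i, j]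
  refine ⟨fun k => if k = i then 2 - p k else p k, mem_intCorners.2 fun k => ?_, fun h => ?_,
    fun h => ?_⟩
  · have := hp' k
    split_ifs <;> omega
  · have h1 := congrFun h i
    have h2 := hp' i
    simp only [if_true] at h1
    omega
  · have h1 := congrFun h j
    have h2 := hp' j
    rw [if_neg hij.symm, opp] at h1
    omega

/-- The values of a harmonic function at two points of the segment from the center of a cell to its
corner `p` are taken on dead end subcells which branch off at these points. This bounds the slope
along the segment by the values on subcells of comparable size. -/
theorem HarmonicInCell.exists_dead_cells (hN : 2 ≤ N) (h : HarmonicInCell H (n + 3) b)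
    (hb : IsOffset b) (hp : p ∈ intCorners N) :
    ∃ c₁ c₂ κ₁ κ₂, IsOffset c₁ ∧ IsOffset c₂ ∧ cell n c₁ ⊆ cell (n + 3) b ∧
      cell n c₂ ⊆ cell (n + 3) b ∧ (∀ x ∈ cell n c₁, H x = κ₁) ∧ (∀ x ∈ cell n c₂, H x = κ₂) ∧
      2 * 3 ^ (n + 1) * |flux H (n + 3) b p| ≤ |κ₁| + |κ₂| := by
  have : NeZero N := ⟨by omega⟩
  obtain ⟨q, hq, hqp, hqo⟩ := exists_third_corner hN hp
  have hpn := corner_mem_intNodes hp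
  have hqn := corner_mem_intNodes hq
  set b₁ := child b p with hb₁
  set b₂ := child b₁ p with hb₂
  have o₁ : IsOffset b₁ := .step b p hb hpn
  have o₂ : IsOffset b₂ := .step b₁ p o₁ hpn
  have H₁ : HarmonicInCell H (n + 2) b₁ := h.restrict hb hpn
  have H₂ : HarmonicInCell H (n + 1) b₂ := H₁.restrict o₁ hpn
  have f₁ : flux H (n + 2) b₁ q = 0 := h.flux_child_eq_zero hb hp hq hqp hqo
  have f₂ : flux H (n + 1) b₂ q = 0 := H₁.flux_child_eq_zero o₁ hp hq hqp hqo
  have k₁ := H₁.eq_center_of_flux_eq_zero o₁ hq f₁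
  have k₂ := H₂.eq_center_of_flux_eq_zero o₂ hq f₂
  have s₁ : cell (n + 1) (child b₁ q) ⊆ cell (n + 3) b :=
    (cell_child_subset hqn).trans (cell_child_subset hpn)
  have s₂ : cell n (child b₂ q) ⊆ cell (n + 3) b :=
    (cell_child_subset hqn).trans ((cell_child_subset hpn).trans (cell_child_subset hpn))
  refine ⟨child (child b₁ q) q, child b₂ q, H (node (n + 2) b₁ 1),
    H (node (n + 1) b₂ 1), .step _ q (.step b₁ q o₁ hqn) hqn, .step b₂ q o₂ hqn,
    (cell_child_subset hqn).trans s₁, s₂, fun x hx => k₁ x (cell_child_subset hqn hx), k₂, ?_⟩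
  have a₁ := (H₁.sum_flux_and_affine o₁).2 p hp
  have a₂ := (H₂.sum_flux_and_affine o₂).2 p hp
  rw [hb₁, ← flux_succ, ← hb₁] at a₁
  rw [hb₂, ← flux_succ, ← node_succ, ← hb₂, hb₁, ← flux_succ, ← hb₁] at a₂
  have h3 : (0 : ℝ) < 3 ^ (n + 1) := by positivity
  have hpow : (3 : ℝ) ^ (n + 2) = 3 * 3 ^ (n + 1) := by ring
  rw [hpow] at a₁
  have hdiff : 2 * 3 ^ (n + 1) * flux H (n + 3) b p =
      H (node (n + 1) b₂ 1) - H (node (n + 2) b₁ 1) := by linarith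
  rw [show 2 * 3 ^ (n + 1) * |flux H (n + 3) b p| = |2 * 3 ^ (n + 1) * flux H (n + 3) b p| by
    rw [abs_mul, abs_of_pos (by positivity : (0 : ℝ) < 2 * 3 ^ (n + 1))], hdiff]
  have htri := abs_add_le (H (node (n + 1) b₂ 1)) (-H (node (n + 2) b₁ 1))
  rw [abs_neg, ← sub_eq_add_neg] at htri
  linarith

/-! ### The Vicsek graph in integer coordinates -/

/-- The point of `ℝ^N` with integer coordinates `a`, in the unit `1 / √N`. -/
def ofInt (a : Fin N → ℤ) : EuclideanSpace ℝ (Fin N) := WithLp.toLp 2 fun k => (a k : ℝ) / √N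

theorem ofInt_apply (a : Fin N → ℤ) (k : Fin N) : ofInt a k = (a k : ℝ) / √N := rfl

theorem sqrt_pos [NeZero N] : 0 < √(N : ℝ) :=
  Real.sqrt_pos.2 (Nat.cast_pos.2 (Nat.pos_of_ne_zero (NeZero.ne N)))

theorem ofInt_injective [NeZero N] : Function.Injective (ofInt (N := N)) := by
  intro a b h
  funext k
  have h1 : ofInt a k = ofInt b k := by rw [h]
  rw [ofInt_apply, ofInt_apply, div_left_inj' sqrt_pos.ne'] at h1
  exact_mod_cast h1

theorem mem_nodes_iff {x : EuclideanSpace ℝ (Fin N)} :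
    x ∈ nodes N ↔ ∃ p ∈ intNodes N, ofInt p = x := by
  constructor
  · rintro (rfl | hx)
    · exact ⟨1, one_mem_intNodes, by ext k; simp [ofInt_apply, center]⟩
    · classical
      refine ⟨fun k => if x k = 0 then 0 else 2, corner_mem_intNodes (mem_intCorners.2 fun k => ?_),
        ?_⟩
      · split_ifs <;> simp
      · ext k
        rw [ofInt_apply]
        rcases hx k with h | h
        · simp [h]
        · by_cases h0 : x k = 0
          · simp [h0]
          · simp only [h0, if_false]
            rw [h]
            norm_num
  · rintro ⟨p, hp, rfl⟩
    rcases mem_intNodes.1 hp with rfl | hp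
    · refine Or.inl ?_
      ext k
      simp [ofInt_apply, center]
    · refine Or.inr fun k => ?_
      rcases mem_intCorners.1 hp k with h | h
      · left; simp [ofInt_apply, h]
      · right; simp [ofInt_apply, h]

theorem mem_scaledLevel_iff {n : ℕ} {x : EuclideanSpace ℝ (Fin N)} :
    x ∈ scaledLevel N n ↔ ∃ a ∈ intLevel N n, ofInt a = x := by
  induction n generalizing x with
  | zero =>
    have h0 : scaledLevel N 0 = nodes N := by simp [scaledLevel, level]
    rw [h0]
    exact mem_nodes_iff
  | succ n ih =>
    rw [mem_scaledLevel_succ]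
    constructor
    · rintro ⟨p, hp, y, hy, rfl⟩
      obtain ⟨q, hq, rfl⟩ := mem_nodes_iff.1 hp
      obtain ⟨a, ha, rfl⟩ := ih.1 hy
      refine ⟨fun k => a k + 2 * 3 ^ n * q k, ⟨q, hq, by simpa using ha⟩, ?_⟩
      ext k
      simp only [ofInt_apply, PiLp.add_apply, PiLp.smul_apply, smul_eq_mul]
      push_cast
      ring
    · rintro ⟨a, ⟨p, hp, ha⟩, rfl⟩
      refine ⟨ofInt p, mem_nodes_iff.2 ⟨p, hp, rfl⟩, _, ih.2 ⟨_, ha, rfl⟩, ?_⟩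
      ext k
      simp only [ofInt_apply, PiLp.add_apply, PiLp.smul_apply, smul_eq_mul]
      push_cast
      ring

theorem exists_coord (v : vertices N) : ∃ a ∈ intVertices N, ofInt a = v.1 := by
  obtain ⟨n, hn⟩ := mem_iUnion.1 v.2
  obtain ⟨a, ha, h⟩ := mem_scaledLevel_iff.1 hn
  exact ⟨a, ⟨n, ha⟩, h⟩

/-- The integer coordinates of a vertex. -/
def coord (v : vertices N) : Fin N → ℤ := (exists_coord v).choose

theorem coord_mem (v : vertices N) : coord v ∈ intVertices N := (exists_coord v).choose_spec.1

theorem ofInt_coord (v : vertices N) : ofInt (coord v) = v.1 := (exists_coord v).choose_spec.2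

theorem coord_injective : Function.Injective (coord (N := N)) := fun v w h => by
  apply Subtype.ext
  rw [← ofInt_coord v, ← ofInt_coord w, h]

theorem exists_coord_eq [NeZero N] {a : Fin N → ℤ} (ha : a ∈ intVertices N) :
    ∃ v : vertices N, coord v = a := by
  obtain ⟨n, hn⟩ := ha
  refine ⟨⟨ofInt a, mem_iUnion.2 ⟨n, mem_scaledLevel_iff.2 ⟨a, hn, rfl⟩⟩⟩, ?_⟩
  exact ofInt_injective (ofInt_coord _)

theorem adj_iff [NeZero N] {v w : vertices N} :
    (graph N).Adj v w ↔ IntJoined (coord v) (coord w) := by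
  have hN : (0 : ℝ) < N := Nat.cast_pos.2 (Nat.pos_of_ne_zero (NeZero.ne N))
  have hs := sqrt_pos (N := N)
  have key : ∀ k, |v.1 k - w.1 k| = 1 / √N ↔
      (coord w k - coord v k = 1 ∨ coord w k - coord v k = -1) := by
    intro k
    rw [← ofInt_coord v, ← ofInt_coord w, ofInt_apply, ofInt_apply, ← sub_div, abs_div,
      abs_of_pos hs, div_left_inj' hs.ne', abs_sub_comm]
    have : |((coord w k : ℤ) : ℝ) - coord v k| = ((|coord w k - coord v k| : ℤ) : ℝ) := by
      push_cast
      rfl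
    rw [this]
    norm_cast
    rw [abs_eq zero_le_one]
    rfl
  constructor
  · exact fun h k => (key k).1 (h.2 k)
  · intro h
    refine ⟨?_, fun k => (key k).2 (h k)⟩
    rw [EuclideanSpace.dist_eq]
    have : ∀ k, dist (v.1 k) (w.1 k) ^ 2 = 1 / (N : ℝ) := by
      intro k
      rw [Real.dist_eq, (key k).2 (h k), div_pow, Real.sq_sqrt hN.le, one_pow]
    simp only [this, Finset.sum_const, Finset.card_univ, Fintype.card_fin, nsmul_eq_mul]
    rw [mul_one_div_cancel hN.ne', Real.sqrt_one]

instance : Countable (vertices N) := coord_injective.countable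

instance : Countable (graph N).edgeSet := by
  have : Countable (Sym2 (vertices N)) :=
    (Quot.mk_surjective (r := Sym2.Rel (vertices N))).countable
  exact Subtype.countable

theorem finite_neighborSet [NeZero N] (v : vertices N) : ((graph N).neighborSet v).Finite := by
  refine Set.Finite.of_finite_image (f := coord) ?_ coord_injective.injOn
  refine ((intCorners N).image (diag (coord v))).finite_toSet.subset ?_
  rintro _ ⟨w, hw, rfl⟩
  obtain ⟨r, hr, h⟩ := (adj_iff.1 hw).exists_diag
  rw [h]
  exact Finset.mem_coe.2 (Finset.mem_image_of_mem _ hr)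

theorem intLaplacian_coord [NeZero N] {H : (Fin N → ℤ) → ℝ} {h : vertices N → ℝ}
    (hH : ∀ v, H (coord v) = h v) (v : vertices N) :
    intLaplacian H (coord v) = ∑ w ∈ (finite_neighborSet v).toFinset, (h w - h v) := by
  classical
  rw [intLaplacian, ← Finset.sum_filter]
  symm
  have hw : ∀ w ∈ (finite_neighborSet v).toFinset, ∃ r ∈ intCorners N,
      coord w = diag (coord v) r := by
    intro w hw
    rw [Set.Finite.mem_toFinset] at hw
    exact (adj_iff.1 hw).exists_diag
  choose! f hf1 hf2 using hw
  refine Finset.sum_bij (fun w _ => f w) (fun w hw => ?_) (fun w hw w' hw' h => ?_)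
    (fun r hr => ?_) (fun w hw => ?_)
  · rw [Finset.mem_filter, ← hf2 w hw]
    exact ⟨hf1 w hw, coord_mem w⟩
  · apply coord_injective
    rw [hf2 w hw, hf2 w' hw', h]
  · rw [Finset.mem_filter] at hr
    obtain ⟨w, hw⟩ := exists_coord_eq hr.2
    have hmem : w ∈ (finite_neighborSet v).toFinset := by
      rw [Set.Finite.mem_toFinset]
      refine adj_iff.2 ?_
      rw [hw]
      exact intJoined_diag _ hr.1
    refine ⟨w, hmem, ?_⟩
    have := hf2 w hmem
    rw [hw] at this
    exact (diag_injective this).symm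
  · rw [← hf2 w hw, hH, hH]

/-! ### Distances -/

theorem abs_coord_sub_le_dist [NeZero N] (v w : vertices N) (k : Fin N) :
    |coord v k - coord w k| ≤ ((graph N).dist v w : ℤ) := by
  have hG := graph_connected (Nat.pos_of_ne_zero (NeZero.ne N))
  obtain ⟨p, hp⟩ := hG.exists_walk_length_eq_dist v w
  rw [← hp]
  clear hp
  induction p with
  | nil => simp
  | cons h p ih =>
    have h1 := adj_iff.1 h k
    rw [SimpleGraph.Walk.length_cons]
    push_cast
    rw [abs_le] at ih ⊢
    omega

/-- Two vertices of a cell of level `n` have graph distance at most `2 * 3^n`. -/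
theorem dist_le_of_mem_cell [NeZero N] {n : ℕ} {b : Fin N → ℤ} (hb : IsOffset b) {v w : vertices N}
    (hv : coord v ∈ cell n b) (hw : coord w ∈ cell n b) :
    ((graph N).dist v w : ℝ) ≤ 2 * 3 ^ n := by
  have hG := graph_connected (Nat.pos_of_ne_zero (NeZero.ne N))
  have : Nonempty (vertices N) := hG.nonempty
  set f : (Fin N → ℤ) → vertices N := Function.invFun coord with hf
  have hfc : ∀ v, f (coord v) = v := Function.leftInverse_invFun coord_injective
  have key := dist_center_le (n := n) (b := b) (fun x y => ((graph N).dist (f x) (f y) : ℝ))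
    (fun x => by simp) (fun x y => by rw [SimpleGraph.dist_comm])
    (fun x y z => by exact_mod_cast hG.dist_triangle) zero_le_one (fun x hx y hy hxy => by
      obtain ⟨x, rfl⟩ := exists_coord_eq (cell_subset_intVertices hb hx)
      obtain ⟨y, rfl⟩ := exists_coord_eq (cell_subset_intVertices hb hy)
      rw [hfc, hfc, SimpleGraph.dist_eq_one_iff_adj.2 (adj_iff.2 hxy), Nat.cast_one])
  have h1 := key _ hv
  have h2 := key _ hw
  simp only [hfc] at h1 h2
  rw [SimpleGraph.dist_comm] at h2
  have h3 : ((graph N).dist v w : ℝ) ≤ (graph N).dist v (f (node n b 1)) +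
      (graph N).dist (f (node n b 1)) w := by exact_mod_cast hG.dist_triangle
  linarith

/-! ### Counting cables -/

theorem intJoined_source_target [NeZero N] (e : (graph N).edgeSet) :
    IntJoined (coord (source (graph N) e)) (coord (target (graph N) e)) :=
  adj_iff.1 (adj_source_target (graph N) e)

/-- Every cable joins the center of a cell of level `0` to a corner of this cell. -/
theorem exists_key [NeZero N] (e : (graph N).edgeSet) :
    ∃ bp : (Fin N → ℤ) × (Fin N → ℤ), IsOffset bp.1 ∧ bp.2 ∈ intCorners N ∧
      Sym2.map coord e.1 = s(node 0 bp.1 1, node 0 bp.1 bp.2) := by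
  obtain ⟨b, hb, h⟩ := exists_cell_zero_of_joined (coord_mem _) (coord_mem _)
    (intJoined_source_target e)
  rw [← mk_source_target (graph N) e, Sym2.map_mk]
  rcases h with ⟨h1, p, hp, h2⟩ | ⟨h1, p, hp, h2⟩
  · exact ⟨(b, p), hb, hp, by simp only [h1, h2]⟩
  · exact ⟨(b, p), hb, hp, by simp only [h1, h2]; exact Sym2.eq_swap⟩

/-- In a cell there are at least as many cables as subcells of level `0`. -/
theorem exists_cables_of_cell [NeZero N] (n : ℕ) {c : Fin N → ℤ} (hc : IsOffset c) :
    ∃ F : Finset (graph N).edgeSet, F.card = (2 ^ N + 1) ^ n ∧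
      ∀ e ∈ F, coord (source (graph N) e) ∈ cell n c ∧ coord (target (graph N) e) ∈ cell n c := by
  classical
  have hex : ∀ b : Fin N → ℤ, IsOffset b → ∃ e : (graph N).edgeSet,
      Sym2.map coord e.1 = s(node 0 b 1, node 0 b 0) := by
    intro b hb
    obtain ⟨v, hv⟩ := exists_coord_eq (cell_subset_intVertices hb
      (node_mem_cell (n := 0) one_mem_intNodes))
    obtain ⟨w, hw⟩ := exists_coord_eq (cell_subset_intVertices hb
      (node_mem_cell (n := 0) (corner_mem_intNodes zero_mem_intCorners)))
    have hadj : (graph N).Adj v w := by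
      rw [adj_iff, hv, hw]
      intro k
      simp only [node, Pi.one_apply, Pi.zero_apply]
      omega
    exact ⟨⟨s(v, w), hadj⟩, by simp only [Sym2.map_mk, hv, hw]⟩
  have hne : Nonempty (graph N).edgeSet := ⟨(hex 0 .zero).choose⟩
  choose! f hf using hex
  refine ⟨(descendants N n).image fun w => f (descend n c w), ?_, fun e he => ?_⟩
  · rw [Finset.card_image_of_injOn, card_descendants]
    intro w hw w' hw' h
    have h1 := hf _ (isOffset_descend hc hw)
    have h2 := hf _ (isOffset_descend hc hw')
    simp only at h
    rw [h, h2] at h1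
    funext k
    rcases Sym2.eq_iff.1 h1 with ⟨h3, -⟩ | ⟨h3, -⟩ <;>
    · have := congrFun h3 k
      simp only [node, descend, Pi.one_apply, Pi.zero_apply] at this
      omega
  · obtain ⟨w, hw, rfl⟩ := Finset.mem_image.1 he
    have h1 := hf _ (isOffset_descend hc hw)
    rw [← mk_source_target (graph N), Sym2.map_mk] at h1
    have hsub : cell 0 (descend n c w) ⊆ cell n c := by
      have := cell_descend_subset (b := c) 0 hw
      rwa [zero_add] at this
    have hm1 := hsub (node_mem_cell one_mem_intNodes)
    have hm0 := hsub (node_mem_cell (corner_mem_intNodes zero_mem_intCorners))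
    rcases Sym2.eq_iff.1 h1 with ⟨h3, h4⟩ | ⟨h3, h4⟩ <;> rw [h3, h4]
    exacts [⟨hm1, hm0⟩, ⟨hm0, hm1⟩]

theorem abs_coord_endpoint_sub_le [NeZero N] {hG : (graph N).Connected}
    (x : PrePoint (graph N) hG) (i j : Bool) (k : Fin N) :
    |coord (x.endpoint i) k - coord (x.endpoint j) k| ≤ 1 := by
  have h := intJoined_source_target x.edge k
  cases i <;> cases j <;> simp only [PrePoint.endpoint] <;> rw [abs_le] <;> omega

/-- A ball of radius at most of the order `3^n` meets at most of the order `(2^N + 1)^n` cables. -/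
theorem exists_cables_of_ball [NeZero N] {hG : (graph N).Connected}
    (x₀ : CableSystem (graph N) hG) (ρ : ℝ) (n A : ℕ) (hρ : ρ + 2 ≤ A * 3 ^ n) :
    ∃ F : Finset (graph N).edgeSet,
      F.card ≤ (2 * A + 3) ^ N * (2 ^ N + 1) ^ n * 2 ^ N ∧
      ∀ e, ∀ t ∈ Icc (0 : ℝ) 1, cablePoint hG e t ∈ Metric.ball x₀ ρ → e ∈ F := by
  classical
  obtain ⟨e₀, a₀, rfl⟩ := exists_eq_proj x₀
  choose key hkey using exists_key (N := N)
  have hinj : Function.Injective key := by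
    intro e e' h
    apply Subtype.ext
    apply Sym2.map.injective coord_injective
    rw [(hkey e).2.2, (hkey e').2.2, h]
  set z : Fin N → ℤ := coord (source (graph N) e₀) with hz
  set q : Fin N → ℤ := fun k => z k / (2 * 3 ^ n) with hq
  set T : Finset ((Fin N → ℤ) × (Fin N → ℤ)) :=
    (((Fintype.piFinset fun k => Finset.Icc (q k - (A + 1)) (q k + (A + 1))) ×ˢ
      descendants N n) ×ˢ intCorners N).image fun s => (descend n s.1.1 s.1.2, s.2) with hT
  refine ⟨T.preimage key hinj.injOn, ?_, fun e t ht hball => ?_⟩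
  · refine (Finset.card_le_card_of_injOn key (fun e he => Finset.mem_preimage.1 he)
      hinj.injOn).trans ?_
    refine Finset.card_image_le.trans (le_of_eq ?_)
    rw [Finset.card_product, Finset.card_product, card_descendants, card_intCorners,
      Fintype.card_piFinset]
    congr 2
    simp only [Int.card_Icc]
    rw [Finset.prod_congr rfl (g := fun _ => 2 * A + 3) fun k _ => by omega]
    simp
  rw [Finset.mem_preimage]
  obtain ⟨hb, hp, hs⟩ := hkey e
  obtain ⟨β, w, hβ, hw, hbw⟩ := hb.exists_descend n
  refine Finset.mem_image.2 ⟨((β, w), (key e).2), ?_, by rw [← hbw]⟩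
  refine Finset.mem_product.2 ⟨Finset.mem_product.2 ⟨?_, hw⟩, hp⟩
  rw [Fintype.mem_piFinset]
  intro k
  -- The center of the cell of level `0` containing `e` is close to the end points of `e₀`.
  set x : PrePoint (graph N) hG := ⟨e, ⟨t, ht⟩⟩ with hx
  set y : PrePoint (graph N) hG := ⟨e₀, a₀⟩ with hy
  have hxy : x.geodDist y < ρ := by
    rw [cablePoint_of_mem e ht] at hball
    exact hball
  obtain ⟨i, j, hij⟩ : ∃ i j, |(coord (x.endpoint i) k : ℝ) - coord (y.endpoint j) k| ≤ ρ := by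
    by_cases he : x.edge = y.edge
    · refine ⟨false, false, ?_⟩
      rw [PrePoint.endpoint_congr he, sub_self, abs_zero]
      exact (dist_nonneg (x := x) (y := y)).trans hxy.le
    · obtain ⟨i, j, hij⟩ := PrePoint.exists_geodDist_eq_via he
      refine ⟨i, j, ?_⟩
      have h1 := abs_coord_sub_le_dist (x.endpoint i) (y.endpoint j) k
      have h2 : |(coord (x.endpoint i) k : ℝ) - coord (y.endpoint j) k| ≤
          (graph N).dist (x.endpoint i) (y.endpoint j) := by exact_mod_cast h1
      have h3 := x.offset_nonneg i
      have h4 := y.offset_nonneg j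
      rw [PrePoint.via] at hij
      linarith
  obtain ⟨l, hl⟩ : ∃ l, coord (x.endpoint l) = node 0 (key e).1 1 := by
    rw [← mk_source_target (graph N) e, Sym2.map_mk] at hs
    rcases Sym2.eq_iff.1 hs with ⟨h3, -⟩ | ⟨-, h3⟩
    exacts [⟨false, h3⟩, ⟨true, h3⟩]
  have h1 := abs_coord_endpoint_sub_le x l i k
  have h2 := abs_coord_endpoint_sub_le y j false k
  have h3 : |node 0 (key e).1 1 k - z k| ≤ A * 3 ^ n := by
    have hz' : coord (y.endpoint false) = z := rfl
    rw [hl] at h1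
    rw [hz'] at h2
    have h1' : |(node 0 (key e).1 1 k : ℝ) - coord (x.endpoint i) k| ≤ 1 := by exact_mod_cast h1
    have h2' : |(coord (y.endpoint j) k : ℝ) - z k| ≤ 1 := by exact_mod_cast h2
    have : |(node 0 (key e).1 1 k : ℝ) - z k| ≤ A * 3 ^ n := by
      have h4 := abs_sub_le (node 0 (key e).1 1 k : ℝ) (coord (x.endpoint i) k) (z k)
      have h5 := abs_sub_le (coord (x.endpoint i) k : ℝ) (coord (y.endpoint j) k) (z k)
      linarith
    exact_mod_cast this
  have h4 : node 0 (key e).1 1 k = 1 + 2 * (3 ^ n * β k + w k) := by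
    simp [node, hbw, descend]
  have h5 := descendants_bounds hw k
  have hpos : (0 : ℤ) < 3 ^ n := by positivity
  have h6 : z k = 2 * 3 ^ n * q k + z k % (2 * 3 ^ n) := by
    rw [hq]
    exact (Int.mul_ediv_add_emod _ _).symm
  have h7 := Int.emod_nonneg (z k) (by positivity : (2 * 3 ^ n : ℤ) ≠ 0)
  have h8 := Int.emod_lt_of_pos (z k) (by positivity : (0 : ℤ) < 2 * 3 ^ n)
  rw [h4, abs_le] at h3
  have hA : (0 : ℤ) ≤ A := Nat.cast_nonneg _
  suffices hβk : q k - (A + 1) ≤ β k ∧ β k ≤ q k + (A + 1) from Finset.mem_Icc.2 hβk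
  constructor
  · by_contra hcon
    have : β k + 1 ≤ q k - (A + 1) := by omega
    nlinarith [mul_le_mul_of_nonneg_left this hpos.le, mul_nonneg hA hpos.le]
  · by_contra hcon
    have : q k + (A + 1) + 1 ≤ β k := by omega
    nlinarith [mul_le_mul_of_nonneg_left this hpos.le, mul_nonneg hA hpos.le]

theorem cableMeasure_real_ball_le [NeZero N] {hG : (graph N).Connected}
    (x₀ : CableSystem (graph N) hG) {ρ : ℝ} (hρ0 : 0 ≤ ρ) (n A : ℕ) (hρ : ρ + 2 ≤ A * 3 ^ n) :
    cableMeasure (graph N) hG (Metric.ball x₀ ρ) < ∞ ∧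
    (cableMeasure (graph N) hG).real (Metric.ball x₀ ρ) ≤
      (2 * A + 3) ^ N * (2 ^ N + 1) ^ n * 2 ^ N * min 1 (2 * ρ) := by
  obtain ⟨F, hF, hFb⟩ := exists_cables_of_ball x₀ ρ n A hρ
  have h := cableMeasure_ball_le F hFb
  have hmin : 0 ≤ min 1 (2 * ρ) := le_min zero_le_one (by linarith)
  refine ⟨h.trans_lt ENNReal.ofReal_lt_top, ?_⟩
  refine (ENNReal.toReal_le_of_le_ofReal (mul_nonneg (Nat.cast_nonneg _) hmin) h).trans ?_
  refine mul_le_mul_of_nonneg_right ?_ hmin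
  exact_mod_cast hF

/-! ### The gradient estimate on large scales -/

/-- If `4 * 3^m ≤ r`, then a cell of level `m` with a cable that meets `B(x₀, r)` lies in
`B(x₀, 2r)`. -/
theorem cablePoint_mem_ball_of_cell [NeZero N] {hG : (graph N).Connected}
    {x₀ : CableSystem (graph N) hG} {r : ℝ} {m : ℕ} (hm : 4 * 3 ^ m ≤ r) {b : Fin N → ℤ}
    (hb : IsOffset b) {e e' : (graph N).edgeSet} {t t' : ℝ} (ht : t ∈ Icc (0 : ℝ) 1)
    (ht' : t' ∈ Icc (0 : ℝ) 1) (hx : cablePoint hG e t ∈ Metric.ball x₀ r)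
    (he : coord (source (graph N) e) ∈ cell m b) (he' : coord (source (graph N) e') ∈ cell m b) :
    cablePoint hG e' t' ∈ Metric.ball x₀ (2 * r) := by
  set x : PrePoint (graph N) hG := ⟨e, ⟨t, ht⟩⟩ with hxdef
  set y : PrePoint (graph N) hG := ⟨e', ⟨t', ht'⟩⟩ with hydef
  have h1 := PrePoint.geodDist_le_via y x false false
  rw [PrePoint.via, PrePoint.offset_false, PrePoint.offset_false] at h1
  have h2 : ((graph N).dist (y.endpoint false) (x.endpoint false) : ℝ) ≤ 2 * 3 ^ m :=
    dist_le_of_mem_cell hb he' he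
  have h3 : (1 : ℝ) ≤ 3 ^ m := one_le_pow₀ (by norm_num)
  have h4 : dist (cablePoint hG e' t') (cablePoint hG e t) = y.geodDist x := by
    rw [cablePoint_of_mem e' ht', cablePoint_of_mem e ht]
    rfl
  have h5 : (y.pos : ℝ) ≤ 1 := ht'.2
  have h6 : (x.pos : ℝ) ≤ 1 := ht.2
  have h7 := dist_triangle (cablePoint hG e' t') (cablePoint hG e t) x₀
  have h8 := Metric.mem_ball.1 hx
  rw [Metric.mem_ball]
  linarith

/-- The gradient estimate on a cell whose size is comparable to the radius. -/
theorem ae_abs_grad_le_of_cell (hN : 2 ≤ N) {hG : (graph N).Connected}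
    {x₀ : CableSystem (graph N) hG} {r : ℝ} {n : ℕ} (hn : 4 * 3 ^ (n + 3) ≤ r)
    {u : CableSystem (graph N) hG → ℝ} (hu : IsHarmonicIn u (Metric.ball x₀ (2 * r)))
    (hI : IntegrableOn u (Metric.ball x₀ (2 * r)) (cableMeasure (graph N) hG)) :
    ∀ᵐ x ∂(cableMeasure (graph N) hG), x ∈ Metric.ball x₀ r →
      |energyGrad u x| * (3 ^ (n + 1) * (2 ^ N + 1) ^ n) ≤
        ∫ x in Metric.ball x₀ (2 * r), |u x| ∂(cableMeasure (graph N) hG) := by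
  have : NeZero N := ⟨by omega⟩
  set D := Metric.ball x₀ (2 * r) with hDdef
  set I := ∫ x in D, |u x| ∂(cableMeasure (graph N) hG) with hIdef
  have hDm : MeasurableSet D := Metric.isOpen_ball.measurableSet
  have hK : (0 : ℝ) < (2 ^ N + 1) ^ n := by positivity
  obtain ⟨v, hvu, hv⟩ := (hasEnergyGrad_energyGrad hu.1).exists_primitive
  obtain ⟨h, hh⟩ := exists_vertex_values v
  set H : (Fin N → ℤ) → ℝ := Function.extend coord h 0 with hHdef
  have hH : ∀ w, H (coord w) = h w := fun w => coord_injective.extend_apply h 0 w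
  refine ae_cableMeasure_iff.2 fun e => ?_
  by_cases hmeet : ∃ t ∈ Icc (0 : ℝ) 1, cablePoint hG e t ∈ Metric.ball x₀ r
  swap
  · filter_upwards [ae_restrict_mem measurableSet_Icc] with t ht hball
    exact absurd ⟨t, ht, hball⟩ hmeet
  obtain ⟨t₀, ht₀, hball⟩ := hmeet
  obtain ⟨b, hb, hsb, htb⟩ := exists_cell_of_joined (coord_mem _) (coord_mem _)
    (intJoined_source_target e) (n + 3)
  have hcell : ∀ e' : (graph N).edgeSet, coord (source (graph N) e') ∈ cell (n + 3) b →
      ∀ t ∈ Icc (0 : ℝ) 1, cablePoint hG e' t ∈ D := fun e' he' t ht =>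
    cablePoint_mem_ball_of_cell hn hb ht₀ ht hball hsb he'
  have hharm : HarmonicInCell H (n + 3) b := by
    intro x hx hxc
    obtain ⟨w, rfl⟩ := exists_coord_eq (cell_subset_intVertices hb hx)
    rw [intLaplacian_coord hH]
    refine hu.sum_sub_eq_zero hv hh w _ (fun y => by simp) fun e' he' => hcell e' ?_
    rw [← mk_source_target (graph N) e', Sym2.mem_iff] at he'
    rcases he' with rfl | rfl
    · exact hx
    · exact mem_cell_of_joined hb hx hxc (coord_mem _) (intJoined_source_target e').symm
  have hconst : ∀ c κ, IsOffset c → cell n c ⊆ cell (n + 3) b → (∀ x ∈ cell n c, H x = κ) →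
      (2 ^ N + 1) ^ n * |κ| ≤ I := by
    intro c κ hc hsub hκ
    obtain ⟨F, hcard, hF⟩ := exists_cables_of_cell n hc
    have hFD : ∀ e' ∈ F, ∀ t ∈ Icc (0 : ℝ) 1, cablePoint hG e' t ∈ D := fun e' he' =>
      hcell e' (hsub (hF e' he').1)
    have hle := card_mul_abs_le hDm hI hvu F κ hFD fun e' he' t ht => by
      rw [(hu.affine_on_cable hv e' (hFD e' he')).1 t ht, (hh e').1, (hh e').2, ← hH, ← hH,
        hκ _ (hF e' he').1, hκ _ (hF e' he').2]
      ring
    rw [hcard] at hle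
    exact_mod_cast hle
  have hflux : ∀ p ∈ intCorners N, |flux H (n + 3) b p| ≤ I / (3 ^ (n + 1) * (2 ^ N + 1) ^ n) := by
    intro p hp
    obtain ⟨c₁, c₂, κ₁, κ₂, hc₁, hc₂, hs₁, hs₂, hκ₁, hκ₂, hle⟩ := hharm.exists_dead_cells hN hb hp
    have h1 := hconst c₁ κ₁ hc₁ hs₁ hκ₁
    have h2 := hconst c₂ κ₂ hc₂ hs₂ hκ₂
    rw [le_div_iff₀ (by positivity)]
    have h3 := mul_le_mul_of_nonneg_right hle hK.le
    linarith
  have hgrad := (hu.affine_on_cable hv e (hcell e hsb)).2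
  have hslope : |onCable v e 1 - onCable v e 0| ≤ I / (3 ^ (n + 1) * (2 ^ N + 1) ^ n) := by
    rw [(hh e).1, (hh e).2, ← hH, ← hH]
    exact hharm.abs_sub_le hb hflux htb hsb (intJoined_source_target e).symm
  rw [le_div_iff₀ (by positivity)] at hslope
  filter_upwards [ae_restrict_of_ae hgrad, ae_mem_Ioo] with t ht ht01 _
  have hgt := ht ht01
  rw [onCable_apply] at hgt
  rw [hgt]
  exact hslope

/-! ### The reverse Hölder inequality -/

/-- An `L¹` gradient estimate on `2B` gives the reverse Hölder inequality, provided that its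
constant compensates for the measure of `2B`. -/
theorem eLpNorm_energyGrad_le {hG : (graph N).Connected}
    {x₀ : CableSystem (graph N) hG} {r a M C : ℝ} (ha : 0 < a)
    {u : CableSystem (graph N) hG → ℝ}
    (hfin : cableMeasure (graph N) hG (Metric.ball x₀ (2 * r)) < ∞)
    (hM : (cableMeasure (graph N) hG).real (Metric.ball x₀ (2 * r)) ≤ M) (hC : M / a ≤ C / r)
    (h : ∀ᵐ x ∂(cableMeasure (graph N) hG), x ∈ Metric.ball x₀ r → |energyGrad u x| * a ≤
      ∫ x in Metric.ball x₀ (2 * r), |u x| ∂(cableMeasure (graph N) hG)) :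
    eLpNorm (energyGrad u) ∞ ((cableMeasure (graph N) hG).restrict (Metric.ball x₀ r)) ≤
      ENNReal.ofReal (C / r * ⨍ x in Metric.ball x₀ (2 * r), |u x|
        ∂(cableMeasure (graph N) hG)) := by
  have havg : 0 ≤ ⨍ x in Metric.ball x₀ (2 * r), |u x| ∂(cableMeasure (graph N) hG) := by
    rw [average_eq]
    exact smul_nonneg (inv_nonneg.2 measureReal_nonneg) (integral_nonneg fun _ => abs_nonneg _)
  have hI := measure_smul_setAverage (fun x => |u x|) hfin.ne
  rw [smul_eq_mul] at hI
  rw [eLpNorm_exponent_top]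
  refine eLpNormEssSup_le_of_ae_bound ?_
  rw [ae_restrict_iff' Metric.isOpen_ball.measurableSet]
  filter_upwards [h] with x hx hball
  rw [Real.norm_eq_abs]
  have h1 := hx hball
  rw [← hI, ← le_div_iff₀ ha] at h1
  refine h1.trans ?_
  rw [mul_div_right_comm]
  refine mul_le_mul_of_nonneg_right (le_trans ?_ hC) havg
  exact div_le_div_of_nonneg_right hM ha.le

theorem reverseHolder (hN : 2 ≤ N) (hG : (graph N).Connected) : ReverseHolder (graph N) hG := by
  have : NeZero N := ⟨by omega⟩
  set K : ℝ := (2 * (650 : ℕ) + 3) ^ N * 2 ^ N with hK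
  have hK0 : 0 < K := by positivity
  refine ⟨2592 * K, by positivity, fun x₀ r hr u hu hharm => ?_⟩
  have hL2 : MemLp u 2 (cableMeasure (graph N) hG) := (hasEnergyGrad_energyGrad hu).1
  have hint : cableMeasure (graph N) hG (Metric.ball x₀ (2 * r)) < ∞ →
      IntegrableOn u (Metric.ball x₀ (2 * r)) (cableMeasure (graph N) hG) := by
    intro hfin
    have : IsFiniteMeasure ((cableMeasure (graph N) hG).restrict (Metric.ball x₀ (2 * r))) :=
      ⟨by rwa [Measure.restrict_apply_univ]⟩
    exact (hL2.restrict _).integrable one_le_two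
  rcases lt_or_ge r 108 with hsmall | hlarge
  · -- Below the length of a cable, and up to a constant factor above it, it is enough to consider
    -- a single cable.
    obtain ⟨hfin, hM⟩ := cableMeasure_real_ball_le x₀ (ρ := 2 * r) (by linarith) 0 650
      (by norm_num; linarith)
    have hpos : 0 < min (r / 2) (1 / 2 : ℝ) := lt_min (by linarith) (by norm_num)
    refine eLpNorm_energyGrad_le (a := min (r / 2) (1 / 2) ^ 2 / 6) (by positivity) hfin hM ?_ ?_
    · rw [pow_zero, mul_one, ← hK, div_le_div_iff₀ (by positivity) hr]
      have key : min 1 (2 * (2 * r)) * r ≤ 432 * min (r / 2) (1 / 2) ^ 2 := by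
        rcases le_total r 1 with h1 | h1
        · rw [min_eq_left (by linarith : r / 2 ≤ 1 / 2)]
          nlinarith [min_le_right 1 (2 * (2 * r))]
        · rw [min_eq_right (by linarith : (1 : ℝ) / 2 ≤ r / 2)]
          nlinarith [min_le_left 1 (2 * (2 * r))]
      nlinarith [mul_le_mul_of_nonneg_left key hK0.le]
    · filter_upwards [hharm.ae_abs_grad_le_of_ball hr (hint hfin)] with x hx hball
      have := hx hball
      linarith
  · -- Since `108 = 4 * 3^3`, there is `n` with `4 * 3^(n + 3) ≤ r < 4 * 3^(n + 4)`, and then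
    -- `2 * r + 2 ≤ 650 * 3^n`.
    obtain ⟨n, hn1, hn2⟩ := exists_nat_pow_near (x := r / 108) (y := 3)
      (by linarith) (by norm_num)
    have h3 : (0 : ℝ) < 3 ^ n := by positivity
    have h31 : (1 : ℝ) ≤ 3 ^ n := one_le_pow₀ (by norm_num)
    rw [pow_succ] at hn2
    obtain ⟨hfin, hM⟩ := cableMeasure_real_ball_le x₀ (ρ := 2 * r) (by linarith) n 650
      (by push_cast; linarith)
    have hcell := ae_abs_grad_le_of_cell hN (n := n) (by rw [pow_add]; linarith) hharm (hint hfin)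
    refine eLpNorm_energyGrad_le (by positivity) hfin hM ?_ hcell
    rw [min_eq_left (by linarith), mul_one, div_le_div_iff₀ (by positivity) hr, pow_succ]
    have h5 : (0 : ℝ) < (2 ^ N + 1) ^ n := by positivity
    have h6 : ((2 * (650 : ℕ) + 3 : ℝ) ^ N * (2 ^ N + 1) ^ n * 2 ^ N) * r =
        (K * (2 ^ N + 1) ^ n) * r := by rw [hK]; ring
    rw [h6]
    have h7 : 0 < K * (2 ^ N + 1) ^ n := by positivity
    nlinarith [mul_le_mul_of_nonneg_left hn2.le h7.le, mul_pos h7 h3]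

end Vicsek

end

theorem mainTheorem5 (N : ℕ) (hN : 2 ≤ N) :
    CableSystem.ReverseHolder (Vicsek.graph N)
      (Vicsek.graph_connected (lt_of_lt_of_le Nat.zero_lt_two hN)) :=
  Vicsek.reverseHolder hN _
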